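/- A \emph{metric tree} $T$ is obtained from a finite tree $T_0$ with at least one vertex by replacing each edge with a closed interval of positive length, the end points of the interval being identified with the end vertices of the edge. Its length $|T|$ is the sum of the lengths of these intervals, and $d_T(u,v)$ denotes the length of the unique path in $T$ between the points $u,v\in T$; let $B_T(v,\rho)=\{u\in T : d_T(u,v)\le \rho\}$. A finite sequence $(r_1,\dots,r_m)$ of non-negative reals is a \emph{cover} of $T$ if there are points $v_1,\dots,v_m\in T$ with $T=\bigcup_{i=1}^m B_T(v_i,r_i)$. For $l\in\mathbb R$ let $\mathcal C(T,l)$ be the set of covers $(r_1,\dots,r_m)$ of $T$ (with $m$ arbitrary) such that $\sum_{i=1}^m r_i\le |T|+l$, endowed with the topology inherited from $\bigsqcup_{m\in\mathbb N}\mathbb R_+^m$, where $\mathbb R_+=[0,\infty)$. For a Borel probability measure $\nu$ on $\mathcal C(T,l)$ its \emph{expectation measure} $E\nu$ is the Borel measure on $\mathbb R_+$ given by $E\nu(B)=\int |\{i : r_i\in B\}|\,d\nu(r_1,\dots,r_m)$. Let $\mathbf U[0,r]$ be the uniform probability measure on $[0,r]$. \textbf{Theorem.} Let $\varepsilon,r>0$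 and let $T$ be a metric tree with $|T|\ge 24\,\varepsilon^{-1}r$. Then there exists a Borel probability measure $\nu$ on $\mathcal C(T,r)$ such that $$E\nu\le(1+\varepsilon)\frac{|T|}{r}\,\mathbf U[0,r],$$ that is, $E\nu(B)\le(1+\varepsilon)\frac{|T|}{r}\,\mathbf U[0,r](B)$ for every Borel set $B\subseteq\mathbb R_+$. -/

import Mathlib

open MeasureTheory

universe u

/-- The combinatorial data of a metric tree: a finite non-null tree `graph`, together with
the positive length of the closed interval that replaces each of its edges. -/
structure MetricTree where
  /-- The vertices of the underlying discrete tree. -/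
  V : Type u
  /-- There are finitely many vertices. -/
  finite_V : Finite V
  /-- The underlying discrete tree. -/
  graph : SimpleGraph V
  /-- It is a tree (in particular connected, hence with at least one vertex). -/
  isTree : graph.IsTree
  /-- The length of the interval that replaces a given edge. -/
  len : graph.edgeSet → ℝ
  /-- Each interval has positive length. -/
  len_pos : ∀ e, 0 < len e

namespace MetricTree

/-- The length `|T|` of a metric tree: the sum of the lengths of its intervals. -/
noncomputable def length (T : MetricTree.{u}) : ℝ := ∑ᶠ e : T.graph.edgeSet, T.len e

/-- The length of the edge that underlies a dart (that is, an oriented edge). -/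
def dartLen (T : MetricTree.{u}) (d : T.graph.Dart) : ℝ := T.len ⟨d.edge, d.edge_mem⟩

/-- The disjoint union of the vertices and of one closed interval `[0, dartLen d]` for each
oriented edge `d`; the point `t` of that interval is the one at distance `t` from the initial
vertex of `d`. -/
abbrev PrePoint (T : MetricTree.{u}) : Type u :=
  T.V ⊕ (Σ d : T.graph.Dart, Set.Icc (0 : ℝ) (T.dartLen d))

/-- The identifications: the two orientations of an edge give the same interval, run through in
opposite directions, and the initial point of the interval of `d` is the initial vertex of `d`
(so that its final point is the final vertex of `d`). -/
inductive Glue (T : MetricTree.{u}) : T.PrePoint → T.PrePoint → Prop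
  | start (d : T.graph.Dart) (t : Set.Icc (0 : ℝ) (T.dartLen d)) (ht : (t : ℝ) = 0) :
      Glue T (Sum.inr ⟨d, t⟩) (Sum.inl d.fst)
  | flip (d : T.graph.Dart) (t : Set.Icc (0 : ℝ) (T.dartLen d))
      (t' : Set.Icc (0 : ℝ) (T.dartLen d.symm)) (h : (t : ℝ) + t' = T.dartLen d) :
      Glue T (Sum.inr ⟨d, t⟩) (Sum.inr ⟨d.symm, t'⟩)

/-- The points of the metric tree: each edge of the discrete tree is replaced by a closed
interval, whose end points are identified with the end vertices of the edge. -/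
def Point (T : MetricTree.{u}) : Type u := Quot T.Glue

/-- A vertex of the discrete tree as a point of the metric tree. -/
def vertex (T : MetricTree.{u}) (v : T.V) : T.Point := Quot.mk _ (Sum.inl v)

/-- The point at distance `t` from the initial vertex on the oriented edge `d`. -/
def onEdge (T : MetricTree.{u}) (d : T.graph.Dart) (t : Set.Icc (0 : ℝ) (T.dartLen d)) :
    T.Point := Quot.mk _ (Sum.inr ⟨d, t⟩)

/-- `T.HasPath x y L` : there is a path of length `L` from `x` to `y` in the metric tree that
consists of finitely many pieces, each of which runs monotonically inside one edge. -/
inductive HasPath (T : MetricTree.{u}) (x : T.Point) : T.Point → ℝ → Prop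
  | refl : HasPath T x x 0
  | step (d : T.graph.Dart) (s t : Set.Icc (0 : ℝ) (T.dartLen d)) (L : ℝ)
      (h : HasPath T x (T.onEdge d s) L) :
      HasPath T x (T.onEdge d t) (L + |(t : ℝ) - s|)

/-- The distance `d_T(x, y)`: the length of a shortest path from `x` to `y`, which is the length
of the unique simple path `T[x, y]`. -/
noncomputable def dist (T : MetricTree.{u}) (x y : T.Point) : ℝ := sInf {L : ℝ | T.HasPath x y L}

/-- The closed ball `B_T(v, r)`. -/
def closedBall (T : MetricTree.{u}) (v : T.Point) (r : ℝ) : Set T.Point := {x | T.dist v x ≤ r}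

end MetricTree

/-- Finite sequences of real numbers, of arbitrary length, as the disjoint union of the spaces
`ℝ ^ m`. It carries the topology and the `σ`-algebra of the disjoint union. -/
abbrev RadiiSeq : Type := Σ m : ℕ, (Fin m → ℝ)

/-- The `σ`-algebra on finite sequences is the Borel `σ`-algebra. -/
instance RadiiSeq.borelSpace : BorelSpace RadiiSeq := by
  constructor
  apply le_antisymm
  · intro s hs
    have hs' : ∀ m : ℕ, MeasurableSet ((fun f : Fin m → ℝ => (⟨m, f⟩ : RadiiSeq)) ⁻¹' s) :=
      fun m => MeasurableSpace.measurableSet_iInf.1 hs m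
    let _ : MeasurableSpace RadiiSeq := borel RadiiSeq
    have _ : BorelSpace RadiiSeq := ⟨rfl⟩
    have hU : s = ⋃ m : ℕ, (fun f : Fin m → ℝ => (⟨m, f⟩ : RadiiSeq)) ''
        ((fun f : Fin m → ℝ => (⟨m, f⟩ : RadiiSeq)) ⁻¹' s) := by
      ext ⟨m, f⟩
      simp only [Set.mem_iUnion, Set.mem_image, Set.mem_preimage]
      constructor
      · exact fun h => ⟨m, f, h, rfl⟩
      · rintro ⟨k, g, h, e⟩
        exact e ▸ h
    rw [hU]
    refine MeasurableSet.iUnion fun m => ?_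
    have he : Topology.IsOpenEmbedding (fun f : Fin m → ℝ => (⟨m, f⟩ : RadiiSeq)) :=
      Topology.IsOpenEmbedding.sigmaMk (σ := fun m : ℕ => Fin m → ℝ) (i := m)
    exact he.measurableEmbedding.measurableSet_image.2 (hs' m)
  · refine MeasurableSpace.generateFrom_le fun s hs => ?_
    refine MeasurableSpace.measurableSet_iInf.2 fun m => ?_
    exact (isOpen_sigma_iff.1 hs m).measurableSet

/-- `#(B, R)`: the number of components of the sequence `R` that lie in `B`. -/
noncomputable def RadiiSeq.count (B : Set ℝ) (R : RadiiSeq) : ℕ := {i | R.2 i ∈ B}.ncard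

theorem RadiiSeq.count_eq_sum (B : Set ℝ) (R : RadiiSeq) :
    (RadiiSeq.count B R : ENNReal) = ∑ i, B.indicator (fun _ => (1 : ENNReal)) (R.2 i) := by
  classical
  simp only [RadiiSeq.count, Set.indicator_apply, Finset.sum_boole]
  rw [Set.ncard_eq_toFinset_card']
  simp

theorem RadiiSeq.measurable_count {B : Set ℝ} (hB : MeasurableSet B) :
    Measurable (fun R : RadiiSeq => (RadiiSeq.count B R : ENNReal)) := by
  simp only [RadiiSeq.count_eq_sum]
  intro s hs
  refine MeasurableSpace.measurableSet_iInf.2 fun m => ?_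
  have h : Measurable fun f : Fin m → ℝ => ∑ i, B.indicator (fun _ => (1 : ENNReal)) (f i) :=
    Finset.measurable_sum _ fun i _ =>
      (measurable_const.indicator hB).comp (measurable_pi_apply i)
  exact h hs

/-- The expectation measure `E ν` of a measure `ν` on a set `S` of finite sequences:
`E ν (B) = ∫ #(B, R) dν(R)` for every Borel set `B`. -/
noncomputable def expectationMeasure {S : Set RadiiSeq} (ν : Measure S) : Measure ℝ :=
  Measure.ofMeasurable (fun B _ => ∫⁻ R : S, (RadiiSeq.count B R : ENNReal) ∂ν)
    (by simp [RadiiSeq.count])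
    (by
      intro f hf hd
      rw [← lintegral_tsum (f := fun i (R : S) => (RadiiSeq.count (f i) R : ENNReal)) fun i =>
        ((RadiiSeq.measurable_count (hf i)).comp measurable_subtype_coe).aemeasurable]
      refine lintegral_congr fun R => ?_
      simp only [RadiiSeq.count_eq_sum]
      rw [Summable.tsum_finsetSum fun i _ => ENNReal.summable]
      refine Finset.sum_congr rfl fun i _ => ?_
      have h := measure_iUnion (μ := Measure.dirac (R.1.2 i)) hd hf
      simp only [Measure.dirac_apply' _ (MeasurableSet.iUnion hf),
        Measure.dirac_apply' _ (hf _)] at h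
      exact h)

theorem expectationMeasure_apply {S : Set RadiiSeq} (ν : Measure S) {B : Set ℝ}
    (hB : MeasurableSet B) :
    expectationMeasure ν B = ∫⁻ R : S, (RadiiSeq.count B R : ENNReal) ∂ν :=
  Measure.ofMeasurable_apply B hB

/-- The uniform probability measure `U[a, b]` on the interval `[a, b]`, for `a < b`: normalized
Lebesgue measure. -/
noncomputable def uniformMeasure (a b : ℝ) : Measure ℝ :=
  ProbabilityTheory.cond volume (Set.Icc a b)

namespace MetricTree

/-- A finite sequence of non-negative reals is a cover of `T` if `T` is a union of closed balls
with these radii. -/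
def IsCover (T : MetricTree.{u}) (R : RadiiSeq) : Prop :=
  (∀ i, 0 ≤ R.2 i) ∧ ∃ v : Fin R.1 → T.Point, ⋃ i, T.closedBall (v i) (R.2 i) = Set.univ

/-- The set `C(T)` of all covers of `T`. -/
def covers (T : MetricTree.{u}) : Set RadiiSeq := {R | T.IsCover R}

/-- The set `C(T, l)` of `l`-good covers of `T`: the sum of the radii is at most `|T| + l`. -/
def goodCovers (T : MetricTree.{u}) (l : ℝ) : Set RadiiSeq :=
  {R | R ∈ T.covers ∧ ∑ i, R.2 i ≤ T.length + l}

end MetricTree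

/-!
By linear programming duality (the separation theorem), it suffices to find, for any cost `g ≥ 0` of
radii, a cover whose total cost is about `|T| / r` times the average of `g` over `[0, r]`. To pass
between radii and finitely many weights, `[0, r]` is cut into cells of equal length; a radius of
the cover is rounded up to a cell and then replaced by a uniformly distributed point of that cell.

A larger ball can replace a smaller one, so `g` may be taken monotone. Scale `g` to have average `r`
over `[0, r]`, and let `ρ` be the least positive cell boundary such that the average of `g` over
`[0, ρ]` is at most `ρ`. By minimality `g ρ ≤ 2ρ`. Then every tree has a cover of cost at most its length plus
`2ρ` (`IsRootedTree.coverCost`): working from the leaves to the root, one cuts off pieces of cost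
at most their length. Such a piece has length at least `2ρ`, and it is the union of two trees with
the same root of length at most `2ρ` each.

* If the sum of the two heights is at most `2ρ`, then one ball of radius `ρ` covers the piece
  (`HasSpine.exists_ball`), at a cost of at most `2ρ`.
* Otherwise the path joining the deepest leaves of the two trees has length `2ρ + 2w` with
  `0 ≤ w ≤ ρ`. For a random `u` in `[0, ρ]`, it is covered by balls of radii `u, ρ, w - u` if
  `u ≤ w`, and of radii `u, ρ + w - u` if `u > w`. The expected cost is at most `2ρ + 2w`, and
  the expected number of boundaries between consecutive balls in any stretch of the path is at
  most its length divided by `2ρ`. Only the parts of the branches near a boundary are missed.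
  For a boundary at distance `δ` from the foot of a branch one adds, for each point at depth `δ`
  in the branch, a ball that covers everything behind that point. As `g` is monotone, the expected
  cost of these is at most the length of the branch (`IsRootedTree.exists_branch_cost_le`,
  `exists_cost_le`, `HasSpine.coverCost_union`).

The bound on the sum of the radii comes for free: any radii with sum at least `|T|` cover `T`
greedily (`IsRootedTree.exists_cover_of_length_le_sum`), so a cover can be trimmed
(`trim_mem_goodCovers`).
-/

open scoped ENNReal
open Set

/-! ### Integrals of the cost function -/

theorem setLIntegral_Ioc_add_left (f : ℝ → ℝ≥0∞) (a b c : ℝ) :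
    ∫⁻ x in Ioc a b, f (c + x) = ∫⁻ x in Ioc (c + a) (c + b), f x := by
  rw [← (measurePreserving_add_left volume c).setLIntegral_comp_preimage_emb
    (measurableEmbedding_addLeft c) f]
  simp

theorem setLIntegral_Ioc_sub_left (f : ℝ → ℝ≥0∞) (a b c : ℝ) :
    ∫⁻ x in Ioc a b, f (c - x) = ∫⁻ x in Ioc (c - b) (c - a), f x := by
  have h : MeasurePreserving (fun x : ℝ => c - x) volume volume :=
    Measure.measurePreserving_sub_left volume c
  rw [setLIntegral_congr (Ioc_ae_eq_Icc (a := a) (b := b)),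
    setLIntegral_congr (Ioc_ae_eq_Icc (a := c - b) (b := c - a)),
    ← h.setLIntegral_comp_preimage_emb (MeasurableEquiv.subLeft c).measurableEmbedding f]
  simp

theorem lintegral_comp_two_mul {f : ℝ → ℝ≥0∞} (hf : Measurable f) :
    2 * ∫⁻ x, f (2 * x) = ∫⁻ x, f x := by
  rw [← lintegral_map hf (measurable_const_mul (2 : ℝ)), Real.map_volume_mul_left two_ne_zero,
    lintegral_smul_measure, smul_eq_mul, ← mul_assoc]
  have : (2 : ℝ≥0∞) * ENNReal.ofReal |(2 : ℝ)⁻¹| = 1 := by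
    rw [abs_of_pos (by norm_num), ENNReal.ofReal_inv_of_pos (by norm_num)]
    norm_num
    exact ENNReal.mul_inv_cancel (by norm_num) (by norm_num)
  rw [this, one_mul]

theorem setLIntegral_Ioc_add_Ioc (f : ℝ → ℝ≥0∞) {a b c : ℝ} (hab : a ≤ b) (hbc : b ≤ c) :
    (∫⁻ x in Ioc a b, f x) + ∫⁻ x in Ioc b c, f x = ∫⁻ x in Ioc a c, f x := by
  rw [← Ioc_union_Ioc_eq_Ioc hab hbc, lintegral_union measurableSet_Ioc
    (Ioc_disjoint_Ioc_of_le le_rfl)]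

/-- If a monotone cost has average at most `ρ` over `[0, ρ]`, then also over `[0, s]` for `s ≤ ρ`. -/
theorem Monotone.setLIntegral_Ioc_le {g : ℝ → ℝ≥0∞} (hg : Monotone g) {ρ s : ℝ}
    (hG : ∫⁻ x in Ioc 0 ρ, g x ≤ ENNReal.ofReal (ρ * ρ)) (hs : 0 ≤ s) (hsρ : s ≤ ρ) :
    ∫⁻ x in Ioc 0 s, g x ≤ ENNReal.ofReal (ρ * s) := by
  have hρ : 0 ≤ ρ := hs.trans hsρ
  rcases le_total (g s) (ENNReal.ofReal ρ) with h | h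
  · calc ∫⁻ x in Ioc 0 s, g x ≤ ∫⁻ _ in Ioc 0 s, ENNReal.ofReal ρ :=
          setLIntegral_mono measurable_const fun x hx => (hg hx.2).trans h
      _ = ENNReal.ofReal (ρ * s) := by
          rw [setLIntegral_const, Real.volume_Ioc, sub_zero, ENNReal.ofReal_mul hρ]
  · have h1 : ENNReal.ofReal (ρ * (ρ - s)) ≤ ∫⁻ x in Ioc s ρ, g x := by
      calc ENNReal.ofReal (ρ * (ρ - s)) = ∫⁻ _ in Ioc s ρ, ENNReal.ofReal ρ := by
            rw [setLIntegral_const, Real.volume_Ioc, ENNReal.ofReal_mul hρ]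
        _ ≤ _ := setLIntegral_mono hg.measurable fun x hx => h.trans (hg hx.1.le)
    have h2 := setLIntegral_Ioc_add_Ioc g hs hsρ
    have h3 : (∫⁻ x in Ioc 0 s, g x) + ENNReal.ofReal (ρ * (ρ - s))
        ≤ ENNReal.ofReal (ρ * s) + ENNReal.ofReal (ρ * (ρ - s)) := by
      rw [← ENNReal.ofReal_add (by positivity) (mul_nonneg hρ (sub_nonneg.2 hsρ)),
        show ρ * s + ρ * (ρ - s) = ρ * ρ by ring]
      exact (by gcongr : _ ≤ _).trans (h2.le.trans hG)
    exact (ENNReal.add_le_add_iff_right ENNReal.ofReal_ne_top).1 h3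

/-! ### Rooted trees with respect to a length relation -/

section

variable {X : Type*}

/-- `N x y L` is meant to say that `x` and `y` are joined by a path of length at most `L`. -/
structure IsLengthRel (N : X → X → ℝ → Prop) : Prop where
  refl (x : X) : N x x 0
  mono {x y : X} {L L' : ℝ} : N x y L → L ≤ L' → N x y L'
  symm {x y : X} {L : ℝ} : N x y L → N y x L
  trans {x y z : X} {L L' : ℝ} : N x y L → N y z L' → N x z (L + L')

/-- The curve `γ` runs through `[0, L]` with at most unit speed. -/
def IsUnitSpeed (N : X → X → ℝ → Prop) (L : ℝ) (γ : ℝ → X) : Prop :=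
  ∀ p q, 0 ≤ p → p ≤ q → q ≤ L → N (γ p) (γ q) (q - p)

/-- `IsRootedTree N s a h l`: the set `s` is the image of a rooted metric tree of height `h` and
length `l` whose root goes to `a`, by a map that does not increase lengths of paths. Such a tree
is built from single points by growing an edge at the root, whose new end point is the new root,
and by joining two trees at their roots. -/
inductive IsRootedTree (N : X → X → ℝ → Prop) : Set X → X → ℝ → ℝ → Prop
  | point (a : X) : IsRootedTree N {a} a 0 0
  | grow {s : Set X} {a : X} {h l : ℝ} (L : ℝ) (γ : ℝ → X) (hs : IsRootedTree N s a h l)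
      (hL : 0 ≤ L) (ha : γ 0 = a) (hγ : IsUnitSpeed N L γ) :
      IsRootedTree N (s ∪ γ '' Icc 0 L) (γ L) (h + L) (l + L)
  | join {s s' : Set X} {a : X} {h h' l l' : ℝ} (hs : IsRootedTree N s a h l)
      (hs' : IsRootedTree N s' a h' l') :
      IsRootedTree N (s ∪ s') a (max h h') (l + l')

/-- The set `s` is covered by finitely many balls with radii in `[0, ρ]` whose total cost is at
most `c`, when a ball of radius `y` costs `g y`. -/
def CoverCost (N : X → X → ℝ → Prop) (g : ℝ → ℝ≥0∞) (ρ : ℝ) (s : Set X) (c : ℝ≥0∞) : Prop :=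
  ∃ B : List (X × ℝ), (∀ b ∈ B, 0 ≤ b.2 ∧ b.2 ≤ ρ) ∧ (∀ x ∈ s, ∃ b ∈ B, N b.1 x b.2) ∧
    (B.map fun b => g b.2).sum ≤ c

variable {N : X → X → ℝ → Prop} {g : ℝ → ℝ≥0∞} {ρ : ℝ}

theorem CoverCost.empty : CoverCost N g ρ ∅ 0 := ⟨[], by simp, by simp, by simp⟩

theorem CoverCost.ball {s : Set X} {v : X} {y : ℝ} (hy : 0 ≤ y) (hyρ : y ≤ ρ)
    (hs : ∀ x ∈ s, N v x y) : CoverCost N g ρ s (g y) :=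
  ⟨[(v, y)], by simp [hy, hyρ], by simpa using hs, by simp⟩

theorem CoverCost.mono {s t : Set X} {c d : ℝ≥0∞} (h : CoverCost N g ρ s c) (hts : t ⊆ s)
    (hcd : c ≤ d) : CoverCost N g ρ t d := by
  obtain ⟨B, h1, h2, h3⟩ := h
  exact ⟨B, h1, fun x hx => h2 x (hts hx), h3.trans hcd⟩

theorem CoverCost.union {s t : Set X} {c d : ℝ≥0∞} (h : CoverCost N g ρ s c)
    (h' : CoverCost N g ρ t d) : CoverCost N g ρ (s ∪ t) (c + d) := by
  obtain ⟨B, h1, h2, h3⟩ := h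
  obtain ⟨B', h1', h2', h3'⟩ := h'
  refine ⟨B ++ B', ?_, ?_, ?_⟩
  · intro b hb
    rcases List.mem_append.1 hb with hb | hb
    exacts [h1 b hb, h1' b hb]
  · rintro x (hx | hx)
    · obtain ⟨b, hb, hbx⟩ := h2 x hx
      exact ⟨b, List.mem_append_left _ hb, hbx⟩
    · obtain ⟨b, hb, hbx⟩ := h2' x hx
      exact ⟨b, List.mem_append_right _ hb, hbx⟩
  · rw [List.map_append, List.sum_append]
    exact add_le_add h3 h3'

theorem IsUnitSpeed.shift {L : ℝ} {γ : ℝ → X} (hγ : IsUnitSpeed N L γ) {b : ℝ}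
    (hb : 0 ≤ b) : IsUnitSpeed N (L - b) fun p => γ (b + p) := by
  intro p q hp hpq hq
  have := hγ (b + p) (b + q) (by linarith) (by linarith) (by linarith)
  simpa using this

theorem IsUnitSpeed.mono {L L' : ℝ} {γ : ℝ → X} (hγ : IsUnitSpeed N L γ)
    (h : L' ≤ L) : IsUnitSpeed N L' γ := fun p q hp hpq hq => hγ p q hp hpq (hq.trans h)

/-- Two curves of at most unit speed, one after the other. -/
theorem IsUnitSpeed.append (hN : IsLengthRel N) {L L' : ℝ} {γ δ : ℝ → X}
    (hγ : IsUnitSpeed N L γ) (hδ : IsUnitSpeed N L' δ) (h : δ 0 = γ L) :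
    IsUnitSpeed N (L + L') fun p => if p ≤ L then γ p else δ (p - L) := by
  intro p q hp hpq hq
  by_cases h1 : q ≤ L
  · simpa [h1, hpq.trans h1] using hγ p q hp hpq h1
  · by_cases h2 : p ≤ L
    · simp only [h1, h2, if_true, if_false]
      have e1 := hγ p L hp h2 le_rfl
      have e2 := hδ 0 (q - L) le_rfl (by linarith) (by linarith)
      rw [h] at e2
      exact hN.mono (hN.trans e1 e2) (by linarith)
    · simp only [h1, h2, if_false]
      exact hN.mono (hδ (p - L) (q - L) (by linarith) (by linarith) (by linarith)) (by linarith)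

namespace IsRootedTree

variable {s : Set X} {a : X} {h l : ℝ}

theorem height_nonneg (hs : IsRootedTree N s a h l) : 0 ≤ h := by
  induction hs with
  | point => exact le_rfl
  | grow L γ _ hL _ _ ih => linarith
  | join _ _ ih _ => exact le_max_of_le_left ih

theorem height_le_length (hs : IsRootedTree N s a h l) : h ≤ l := by
  induction hs with
  | point => exact le_rfl
  | grow L γ _ hL _ _ ih => linarith
  | join h1 h2 ih ih' =>
    have := h1.height_nonneg
    have := h2.height_nonneg
    exact max_le (by linarith) (by linarith)

theorem near_root (hN : IsLengthRel N) (hs : IsRootedTree N s a h l) :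
    ∀ x ∈ s, N a x h := by
  induction hs with
  | point a => rintro x rfl; exact hN.refl x
  | @grow s a h l L γ hs hL ha hγ ih =>
    rintro x (hx | ⟨q, hq, rfl⟩)
    · have := hγ 0 L le_rfl hL le_rfl
      rw [ha] at this
      exact hN.mono (hN.trans (hN.symm this) (ih x hx)) (by linarith)
    · exact hN.mono (hN.symm (hγ q L hq.1 hq.2 le_rfl))
        (by linarith [hs.height_nonneg, hq.1])
  | join _ _ ih ih' =>
    rintro x (hx | hx)
    · exact hN.mono (ih x hx) (le_max_left _ _)
    · exact hN.mono (ih' x hx) (le_max_right _ _)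

/-- Attaching a tree at any point of another one. -/
theorem attach {t : Set X} {b : X} {h' l' : ℝ}
    (ht : IsRootedTree N t b h' l') (hs : IsRootedTree N s a h l) (hb : b ∈ s) :
    ∃ h'', IsRootedTree N (s ∪ t) a h'' (l + l') := by
  induction hs with
  | point a =>
    obtain rfl : b = a := hb
    exact ⟨_, (IsRootedTree.point b).join ht⟩
  | @grow s a h l L γ hs hL ha hγ ih =>
    rcases hb with hb | ⟨q, hq, rfl⟩
    · obtain ⟨h'', H⟩ := ih hb
      refine ⟨h'' + L, ?_⟩
      convert H.grow L γ hL ha hγ using 1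
      · ext x; simp only [mem_union]; tauto
      · ring
    · have H := ((hs.grow q γ hq.1 ha (hγ.mono hq.2)).join ht).grow (L - q) (fun p => γ (q + p))
        (by linarith [hq.2]) (by simp) (hγ.shift hq.1)
      refine ⟨max (h + q) h' + (L - q), ?_⟩
      convert H using 1
      · have : γ '' Icc 0 L = γ '' Icc 0 q ∪ (fun p => γ (q + p)) '' Icc 0 (L - q) := by
          rw [← Icc_union_Icc_eq_Icc hq.1 hq.2, image_union]
          congr 1
          rw [show (fun p => γ (q + p)) = γ ∘ fun p => q + p from rfl, image_comp]
          simp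
        rw [this]
        ext x; simp only [mem_union]; tauto
      · simp
      · ring
  | @join s s' a h1 h1' l1 l1' hs hs' ih ih' =>
    rcases hb with hb | hb
    · obtain ⟨h'', H⟩ := ih hb
      refine ⟨max h'' h1', ?_⟩
      convert H.join hs' using 1
      · ext x; simp only [mem_union]; tauto
      · ring
    · obtain ⟨h'', H⟩ := ih' hb
      refine ⟨max h1 h'', ?_⟩
      convert hs.join H using 1
      · ext x; simp only [mem_union]; tauto
      · ring

/-! ### Greedy covers -/

/-- In a tree of height more than `y` there is a ball of radius `y`, centred at height `y` above
a deepest leaf, that leaves a tree of length smaller by at least `y`. -/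
theorem exists_cut (hN : IsLengthRel N) {y : ℝ} (hy : 0 ≤ y) (hs : IsRootedTree N s a h l)
    (hyh : y < h) : ∃ (v : X) (t : Set X) (h' l' : ℝ), IsRootedTree N t a h' l' ∧ l' ≤ l - y ∧
      ∀ x ∈ s, N v x y ∨ x ∈ t := by
  induction hs with
  | point a => exact absurd hyh (not_lt_of_ge hy)
  | @grow s a h l L γ hs hL ha hγ ih =>
    by_cases hh : y < h
    · obtain ⟨v, t, h', l', ht, hl, hc⟩ := ih hh
      refine ⟨v, _, _, _, ht.grow L γ hL ha hγ, by linarith, ?_⟩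
      rintro x (hx | hx)
      · exact (hc x hx).imp id fun h => Or.inl h
      · exact Or.inr (Or.inr hx)
    · push Not at hh
      have h0 := hs.height_nonneg
      have hb : 0 ≤ y - h := sub_nonneg.2 hh
      have H := (IsRootedTree.point (N := N) (γ (y - h))).grow (L - (y - h))
        (fun p => γ (y - h + p)) (by linarith) (by simp) (hγ.shift hb)
      rw [show y - h + (L - (y - h)) = L by ring] at H
      refine ⟨γ (y - h), _, _, _, H, by linarith [hs.height_le_length], ?_⟩
      rintro x (hx | ⟨q, hq, rfl⟩)
      · left
        have := hγ 0 (y - h) le_rfl hb (by linarith)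
        rw [ha] at this
        exact hN.mono (hN.trans (hN.symm this) (hs.near_root hN x hx)) (by linarith)
      · rcases le_total q (y - h) with hq' | hq'
        · exact Or.inl (hN.mono (hN.symm (hγ q _ hq.1 hq' (by linarith))) (by linarith [hq.1]))
        · exact Or.inr (Or.inr ⟨q - (y - h), ⟨by linarith, by linarith [hq.2]⟩, by simp⟩)
  | @join s s' a h1 h1' l1 l1' hs hs' ih ih' =>
    rcases lt_max_iff.1 hyh with hh | hh
    · obtain ⟨v, t, h', l', ht, hl, hc⟩ := ih hh
      refine ⟨v, _, _, _, ht.join hs', by linarith, ?_⟩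
      rintro x (hx | hx)
      · exact (hc x hx).imp id fun h => Or.inl h
      · exact Or.inr (Or.inr hx)
    · obtain ⟨v, t, h', l', ht, hl, hc⟩ := ih' hh
      refine ⟨v, _, _, _, hs.join ht, by linarith, ?_⟩
      rintro x (hx | hx)
      · exact Or.inr (Or.inl hx)
      · exact (hc x hx).imp id fun h => Or.inr h

/-- A non-empty sequence of radii whose sum is at least the length of the tree covers it. -/
theorem exists_cover_of_length_le_sum (hN : IsLengthRel N) {k : ℕ} (hk : 0 < k) (R : Fin k → ℝ)
    (hR : ∀ i, 0 ≤ R i) (hs : IsRootedTree N s a h l) (hl : l ≤ ∑ i, R i) :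
    ∃ v : Fin k → X, ∀ x ∈ s, ∃ i, N (v i) x (R i) := by
  induction k generalizing s h l with
  | zero => exact absurd hk (lt_irrefl 0)
  | succ k ih =>
    rcases le_or_gt h (R 0) with hh | hh
    · exact ⟨fun _ => a, fun x hx => ⟨0, hN.mono (hs.near_root hN x hx) hh⟩⟩
    · obtain ⟨v, t, h', l', ht, hl', hc⟩ := hs.exists_cut hN (hR 0) hh
      rw [Fin.sum_univ_succ] at hl
      have hk' : 0 < k := by
        rcases Nat.eq_zero_or_pos k with rfl | hk'
        · simp only [Finset.univ_eq_empty, Finset.sum_empty, add_zero] at hl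
          linarith [hs.height_le_length]
        · exact hk'
      obtain ⟨w, hw⟩ := ih hk' (fun i => R i.succ) (fun i => hR _) ht (by linarith)
      refine ⟨Fin.cons v w, fun x hx => ?_⟩
      rcases hc x hx with h1 | h1
      · exact ⟨0, h1⟩
      · obtain ⟨i, hi⟩ := hw x h1
        exact ⟨i.succ, by simpa using hi⟩

end IsRootedTree

end

/-! ### Branches and spines -/

section

variable {X : Type*} {N : X → X → ℝ → Prop} {g : ℝ → ℝ≥0∞} {ρ : ℝ}

namespace IsRootedTree

variable {s : Set X} {a : X} {h l : ℝ}

/-- The part of a tree of height `h ≤ ρ` that is not reached by a ball going `δ` deep into it from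
the root is covered at a cost `c δ` with `∫ c ≤ G h + ρ (l - h)`, where `G h` is the integral of
`g` over `[0, h]`: each point at depth `δ` is the centre of one ball, whose radius is the height of
the tree behind that point. When two trees are joined, the higher one keeps the term `G h`, and for
the other one `G h' ≤ ρ h'`. -/
theorem exists_branch_cost (hN : IsLengthRel N) (hg : Monotone g)
    (hG : ∫⁻ x in Ioc 0 ρ, g x ≤ ENNReal.ofReal (ρ * ρ))
    (hρ : 0 ≤ ρ) (hs : IsRootedTree N s a h l) (hhρ : h ≤ ρ) :
    ∃ c : ℝ → ℝ≥0∞, Measurable c ∧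
      (∀ δ, 0 ≤ δ → CoverCost N g ρ {x ∈ s | ¬ N a x δ} (c δ)) ∧
      (∫⁻ δ, c δ) + ENNReal.ofReal (ρ * h) ≤
        (∫⁻ x in Ioc 0 h, g x) + ENNReal.ofReal (ρ * l) := by
  induction hs with
  | point a =>
    refine ⟨fun _ => 0, measurable_const, fun δ hδ => ?_, by simp⟩
    refine CoverCost.empty.mono ?_ le_rfl
    rintro x ⟨rfl, hx⟩
    exact hx (hN.mono (hN.refl x) hδ)
  | @grow s a h l L γ hs hL ha hγ ih =>
    have h0 := hs.height_nonneg
    obtain ⟨c, hc, hcov, hint⟩ := ih (by linarith)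
    refine ⟨fun δ => (Ico 0 L).indicator (fun δ => g (h + L - δ)) δ + c (δ - L), ?_, ?_, ?_⟩
    · refine Measurable.add (Measurable.indicator ?_ measurableSet_Ico) (by fun_prop)
      exact hg.measurable.comp (by fun_prop)
    · intro δ hδ
      rcases lt_or_ge δ L with hδL | hδL
      · have hmem : δ ∈ Ico 0 L := ⟨hδ, hδL⟩
        simp only [indicator_of_mem hmem]
        refine (CoverCost.ball (v := γ (L - δ)) (y := h + L - δ) (by linarith) (by linarith)
          ?_).mono (subset_refl _) le_self_add
        rintro x ⟨hx | ⟨q, hq, rfl⟩, hxn⟩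
        · have := hγ 0 (L - δ) le_rfl (by linarith) (by linarith)
          rw [ha] at this
          exact hN.mono (hN.trans (hN.symm this) (hs.near_root hN x hx)) (by linarith)
        · rcases le_total q (L - δ) with hq' | hq'
          · exact hN.mono (hN.symm (hγ q _ hq.1 hq' (by linarith))) (by linarith [hq.1])
          · exact absurd (hN.mono (hN.symm (hγ q L hq.1 hq.2 le_rfl)) (by linarith)) hxn
      · refine (hcov (δ - L) (by linarith)).mono ?_ le_add_self
        rintro x ⟨hx | ⟨q, hq, rfl⟩, hxn⟩
        · refine ⟨hx, fun hax => hxn ?_⟩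
          have := hγ 0 L le_rfl hL le_rfl
          rw [ha] at this
          exact hN.mono (hN.trans (hN.symm this) hax) (by linarith)
        · exact absurd (hN.mono (hN.symm (hγ q L hq.1 hq.2 le_rfl)) (by linarith [hq.1])) hxn
    · rw [lintegral_add_right _ (by fun_prop), lintegral_sub_right_eq_self c L,
        lintegral_indicator measurableSet_Ico, setLIntegral_congr Ico_ae_eq_Ioc,
        setLIntegral_Ioc_sub_left g, ← setLIntegral_Ioc_add_Ioc g h0 (c := h + L) (by linarith),
        mul_add, mul_add, ENNReal.ofReal_add (by positivity) (by positivity),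
        ENNReal.ofReal_add (mul_nonneg hρ (h0.trans hs.height_le_length)) (by positivity)]
      rw [show h + L - L = h by ring, sub_zero]
      calc _ = ((∫⁻ δ, c δ) + ENNReal.ofReal (ρ * h)) + ((∫⁻ x in Ioc h (h + L), g x)
            + ENNReal.ofReal (ρ * L)) := by ring
        _ ≤ ((∫⁻ x in Ioc 0 h, g x) + ENNReal.ofReal (ρ * l)) + ((∫⁻ x in Ioc h (h + L), g x)
            + ENNReal.ofReal (ρ * L)) := by gcongr
        _ = _ := by ring
  | @join s s' a h1 h1' l1 l1' hs hs' ih ih' =>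
    have h0 := hs.height_nonneg
    have h0' := hs'.height_nonneg
    have hl := hs.height_le_length
    have hl' := hs'.height_le_length
    have m1 := (le_max_left h1 h1').trans hhρ
    have m2 := (le_max_right h1 h1').trans hhρ
    obtain ⟨c, hc, hcov, hint⟩ := ih m1
    obtain ⟨c', hc', hcov', hint'⟩ := ih' m2
    refine ⟨fun δ => c δ + c' δ, hc.add hc', fun δ hδ => ?_, ?_⟩
    · refine ((hcov δ hδ).union (hcov' δ hδ)).mono ?_ le_rfl
      rintro x ⟨hx | hx, hn⟩
      exacts [Or.inl ⟨hx, hn⟩, Or.inr ⟨hx, hn⟩]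
    · rw [lintegral_add_left hc, mul_add, ENNReal.ofReal_add (mul_nonneg hρ (h0.trans hl))
        (mul_nonneg hρ (h0'.trans hl'))]
      -- The lower of the two trees has cost at most `ρ` times its length.
      rcases le_total h1' h1 with hle | hle
      · have hb : (∫⁻ δ, c' δ) ≤ ENNReal.ofReal (ρ * l1') := by
          refine (ENNReal.add_le_add_iff_right (a := ENNReal.ofReal (ρ * h1'))
            ENNReal.ofReal_ne_top).1 (hint'.trans ?_)
          rw [add_comm]
          gcongr
          exact hg.setLIntegral_Ioc_le hG h0' m2
        rw [max_eq_left hle]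
        calc _ = ((∫⁻ δ, c δ) + ENNReal.ofReal (ρ * h1)) + ∫⁻ δ, c' δ := by ring
          _ ≤ ((∫⁻ x in Ioc 0 h1, g x) + ENNReal.ofReal (ρ * l1)) + ENNReal.ofReal (ρ * l1') := by
              gcongr
          _ = _ := by ring
      · have hb : (∫⁻ δ, c δ) ≤ ENNReal.ofReal (ρ * l1) := by
          refine (ENNReal.add_le_add_iff_right (a := ENNReal.ofReal (ρ * h1))
            ENNReal.ofReal_ne_top).1 (hint.trans ?_)
          rw [add_comm]
          gcongr
          exact hg.setLIntegral_Ioc_le hG h0 m1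
        rw [max_eq_right hle]
        calc _ = ((∫⁻ δ, c' δ) + ENNReal.ofReal (ρ * h1')) + ∫⁻ δ, c δ := by ring
          _ ≤ ((∫⁻ x in Ioc 0 h1', g x) + ENNReal.ofReal (ρ * l1')) + ENNReal.ofReal (ρ * l1) := by
              gcongr
          _ = _ := by ring

theorem exists_branch_cost_le (hN : IsLengthRel N) (hg : Monotone g)
    (hG : ∫⁻ x in Ioc 0 ρ, g x ≤ ENNReal.ofReal (ρ * ρ))
    (hρ : 0 ≤ ρ) (hs : IsRootedTree N s a h l) (hhρ : h ≤ ρ) :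
    ∃ c : ℝ → ℝ≥0∞, Measurable c ∧
      (∀ δ, 0 ≤ δ → CoverCost N g ρ {x ∈ s | ¬ N a x δ} (c δ)) ∧
      (∫⁻ δ, c δ) ≤ ENNReal.ofReal (ρ * l) := by
  obtain ⟨c, hc, hcov, hint⟩ := hs.exists_branch_cost hN hg hG hρ hhρ
  refine ⟨c, hc, hcov, ?_⟩
  refine (ENNReal.add_le_add_iff_right (a := ENNReal.ofReal (ρ * h))
    ENNReal.ofReal_ne_top).1 (hint.trans ?_)
  rw [add_comm]
  gcongr
  exact hg.setLIntegral_Ioc_le hG hs.height_nonneg hhρ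

end IsRootedTree

/-- Data on the path `γ` (the spine) from a deepest leaf of the tree `s`, at parameter `0`, to its
root `a`, at parameter `h`. Each point `x` of the tree hangs off the spine at some parameter `t`,
at a depth of at most `t` and of at most `l - t`. If consecutive balls cover the spine and two of
them meet at the parameter `p`, then `U p` is the set of points that are deeper than `|p - t|`,
which these balls may miss; it is covered at a cost `d p` whose integral is at most `2ρ (l - h)`.
Depths are not mentioned themselves but only the bounds on them that are needed. -/
structure HasSpine (N : X → X → ℝ → Prop) (g : ℝ → ℝ≥0∞) (ρ : ℝ) (s : Set X) (a : X) (h l : ℝ)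
    (γ : ℝ → X) (U : ℝ → Set X) (d : ℝ → ℝ≥0∞) : Prop where
  unitSpeed : IsUnitSpeed N h γ
  top : γ h = a
  measurable : Measurable d
  cover (p : ℝ) : CoverCost N g ρ (U p) (d p)
  lintegral_le : (∫⁻ p, d p) + ENNReal.ofReal (2 * ρ * h) ≤ ENNReal.ofReal (2 * ρ * l)
  coord : ∀ x ∈ s, ∃ t ∈ Icc 0 h, N (γ t) x t ∧ N (γ t) x (l - t) ∧
    ∀ p, x ∈ U p ∨ N (γ t) x |p - t|

/-- A tree joined at the root to one that is at least as high is a branch at the upper end of the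
spine of the latter. Its branch cost is counted twice, for `p` on either side of the root. -/
theorem HasSpine.join (hN : IsLengthRel N) (hg : Monotone g)
    (hG : ∫⁻ x in Ioc 0 ρ, g x ≤ ENNReal.ofReal (ρ * ρ)) (hρ : 0 ≤ ρ)
    {s s' : Set X} {a : X} {h h' l l' : ℝ} {γ : ℝ → X} {U : ℝ → Set X} {d : ℝ → ℝ≥0∞}
    (hsp : HasSpine N g ρ s a h l γ U d) (hs : IsRootedTree N s a h l)
    (hs' : IsRootedTree N s' a h' l') (hle : h' ≤ h) (hl : l + l' ≤ 2 * ρ) :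
    ∃ γ U d, HasSpine N g ρ (s ∪ s') a h (l + l') γ U d := by
  have hh := hs.height_le_length
  have hh' := hs'.height_le_length
  have h0 := hs.height_nonneg
  have h0' := hs'.height_nonneg
  obtain ⟨c, hc, hcov, hint⟩ := hs'.exists_branch_cost_le hN hg hG hρ (by linarith)
  refine ⟨γ, fun p => U p ∪ {x ∈ s' | ¬ N a x |p - h|}, fun p => d p + (c (p - h) + c (h - p)),
    hsp.unitSpeed, hsp.top, ?_, ?_, ?_, ?_⟩
  · have := hsp.measurable
    fun_prop
  · intro p
    refine (hsp.cover p).union ((hcov _ (abs_nonneg _)).mono (subset_refl _) ?_)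
    rcases le_total h p with hp | hp
    · rw [abs_of_nonneg (sub_nonneg.2 hp)]
      exact le_self_add
    · rw [abs_sub_comm, abs_of_nonneg (sub_nonneg.2 hp)]
      exact le_add_self
  · rw [lintegral_add_left hsp.measurable, lintegral_add_left (by fun_prop),
      lintegral_sub_right_eq_self c h, lintegral_sub_left_eq_self c h, mul_add,
      ENNReal.ofReal_add (mul_nonneg (by linarith) (h0.trans hh))
        (mul_nonneg (by linarith) (h0'.trans hh'))]
    calc _ = ((∫⁻ p, d p) + ENNReal.ofReal (2 * ρ * h)) + ((∫⁻ p, c p) + ∫⁻ p, c p) := by ring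
      _ ≤ ENNReal.ofReal (2 * ρ * l) + (ENNReal.ofReal (ρ * l') + ENNReal.ofReal (ρ * l')) := by
          gcongr
          exact hsp.lintegral_le
      _ = _ := by
          rw [← ENNReal.ofReal_add (mul_nonneg hρ (h0'.trans hh'))
            (mul_nonneg hρ (h0'.trans hh'))]
          congr 2
          ring
  · rintro x (hx | hx)
    · obtain ⟨t, ht, h1, h2, h3⟩ := hsp.coord x hx
      exact ⟨t, ht, h1, hN.mono h2 (by linarith), fun p => (h3 p).imp Or.inl id⟩
    · have := hs'.near_root hN x hx
      refine ⟨h, ⟨h0, le_rfl⟩, ?_, ?_, fun p => ?_⟩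
      · rw [hsp.top]; exact hN.mono this hle
      · rw [hsp.top]; exact hN.mono this (by linarith)
      · rw [hsp.top]
        by_cases hn : N a x |p - h|
        exacts [Or.inr hn, Or.inl (Or.inr ⟨hx, hn⟩)]

theorem IsRootedTree.exists_hasSpine (hN : IsLengthRel N) (hg : Monotone g)
    (hG : ∫⁻ x in Ioc 0 ρ, g x ≤ ENNReal.ofReal (ρ * ρ)) (hρ : 0 ≤ ρ) {s : Set X} {a : X}
    {h l : ℝ} (hs : IsRootedTree N s a h l) (hl : l ≤ 2 * ρ) :
    ∃ γ U d, HasSpine N g ρ s a h l γ U d := by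
  induction hs with
  | point a =>
    refine ⟨fun _ => a, fun _ => ∅, fun _ => 0, ?_, rfl, measurable_const,
      fun _ => CoverCost.empty, by simp, ?_⟩
    · exact fun p q hp hpq hq => hN.mono (hN.refl a) (by linarith)
    · rintro x rfl
      exact ⟨0, by simp, hN.refl x, by simpa using hN.refl x,
        fun p => Or.inr (hN.mono (hN.refl x) (abs_nonneg _))⟩
  | @grow s a h l L δ hs hL ha hδ ih =>
    have h0 := hs.height_nonneg
    have hhl := hs.height_le_length
    obtain ⟨γ, U, d, hsp⟩ := ih (by linarith)
    have hend : (if h + L ≤ h then γ (h + L) else δ (h + L - h)) = δ L := by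
      split_ifs with hc
      · obtain rfl : L = 0 := by linarith
        rw [add_zero, hsp.top, ha]
      · simp
    refine ⟨fun p => if p ≤ h then γ p else δ (p - h), U, d,
      hsp.unitSpeed.append hN hδ (by rw [ha, hsp.top]), hend, hsp.measurable, hsp.cover, ?_, ?_⟩
    · rw [mul_add, mul_add, ENNReal.ofReal_add (by positivity) (by positivity),
        ENNReal.ofReal_add (mul_nonneg (by linarith) (h0.trans hhl)) (by positivity), ← add_assoc]
      gcongr
      exact hsp.lintegral_le
    · rintro x (hx | ⟨q, hq, rfl⟩)
      · obtain ⟨t, ht, h1, h2, h3⟩ := hsp.coord x hx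
        refine ⟨t, ⟨ht.1, ht.2.trans (by linarith)⟩, ?_⟩
        simp only [ht.2, if_true]
        exact ⟨h1, hN.mono h2 (by linarith), h3⟩
      · refine ⟨h + q, ⟨by linarith [hq.1], by linarith [hq.2]⟩, ?_⟩
        have : (if h + q ≤ h then γ (h + q) else δ (h + q - h)) = δ q := by
          split_ifs with hc
          · obtain rfl : q = 0 := le_antisymm (by linarith) hq.1
            rw [add_zero, hsp.top, ha]
          · simp
        simp only [this]
        exact ⟨hN.mono (hN.refl _) (by linarith [hq.1]), hN.mono (hN.refl _) (by linarith [hq.2]),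
          fun p => Or.inr (hN.mono (hN.refl _) (abs_nonneg _))⟩
  | @join s s' a h1 h1' l1 l1' hs hs' ih ih' =>
    have h0 := hs.height_nonneg
    have h0' := hs'.height_nonneg
    have hl1 := hs.height_le_length
    have hl1' := hs'.height_le_length
    rcases le_total h1' h1 with hle | hle
    · obtain ⟨γ, U, d, hsp⟩ := ih (by linarith)
      rw [max_eq_left hle]
      exact hsp.join hN hg hG hρ hs hs' hle hl
    · obtain ⟨γ, U, d, hsp⟩ := ih' (by linarith)
      rw [max_eq_right hle, union_comm, add_comm]
      exact hsp.join hN hg hG hρ hs' hs hle (by linarith)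

end

/-! ### Covering two trees joined at their roots -/

section

variable {X : Type*} {N : X → X → ℝ → Prop} {g : ℝ → ℝ≥0∞} {ρ : ℝ}

/-- A tree of length at most `2ρ` and another one with the same root that is at most as high fit
into one ball of radius `ρ` if the sum of their heights is at most `2ρ`. -/
theorem HasSpine.exists_ball (hN : IsLengthRel N) {s s' : Set X} {a : X} {h h' l : ℝ}
    {γ : ℝ → X} {U : ℝ → Set X} {d : ℝ → ℝ≥0∞} (hsp : HasSpine N g ρ s a h l γ U d)
    (hρ : 0 ≤ ρ) (hs : ∀ x ∈ s, N a x h) (hs' : ∀ x ∈ s', N a x h') (hl : l ≤ 2 * ρ)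
    (hle : h' ≤ h) (hh : h + h' ≤ 2 * ρ) : ∃ v, ∀ x ∈ s ∪ s', N v x ρ := by
  rcases le_total h ρ with hhρ | hhρ
  · refine ⟨a, ?_⟩
    rintro x (hx | hx)
    exacts [hN.mono (hs x hx) hhρ, hN.mono (hs' x hx) (hle.trans hhρ)]
  · refine ⟨γ ρ, ?_⟩
    rintro x (hx | hx)
    · obtain ⟨t, ht, h1, h2, -⟩ := hsp.coord x hx
      rcases le_total t ρ with htρ | htρ
      · exact hN.mono (hN.trans (hN.symm (hsp.unitSpeed t ρ ht.1 htρ hhρ)) h1) (by linarith)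
      · exact hN.mono (hN.trans (hsp.unitSpeed ρ t hρ htρ ht.2) h2) (by linarith)
    · have := hsp.unitSpeed ρ h hρ hhρ le_rfl
      rw [hsp.top] at this
      exact hN.mono (hN.trans this (hs' x hx)) (by linarith)

/-- A point next to a stretch of the spine lies in the ball around the midpoint of the stretch if
its distance from the spine is at most the distance to either end of the stretch. -/
theorem IsUnitSpeed.near_midpoint (hN : IsLengthRel N) {D : ℝ} {γ : ℝ → X}
    (hγ : IsUnitSpeed N D γ) {p q t : ℝ} (hp : 0 ≤ p) (hq : q ≤ D) (hpt : p ≤ t) (htq : t ≤ q)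
    {x : X} (h1 : N (γ t) x (t - p)) (h2 : N (γ t) x (q - t)) :
    N (γ ((p + q) / 2)) x ((q - p) / 2) := by
  rcases le_total t ((p + q) / 2) with h | h
  · exact hN.mono (hN.trans (hN.symm (hγ t _ (by linarith) h (by linarith))) h1) (by linarith)
  · exact hN.mono (hN.trans (hγ _ t (by linarith) h (by linarith)) h2) (by linarith)

/-- For a monotone cost with average at most `ρ` over `[0, ρ]` and with `g ρ ≤ 2ρ`, the average of
the costs of the covers of a path of length `2ρ + 2w` by balls of radii `u, ρ, w - u` (for
`u ≤ w`) or `u, ρ + w - u` (for `w < u ≤ ρ`) is at most its length. The boundaries between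
consecutive balls, at `2u` and `2u + 2ρ`, respectively at `2u`, are uniformly distributed, so that
an extra cost `e p` for a boundary at `p` contributes at most `(∫ e) / (2ρ)`. -/
theorem exists_cost_le (hg : Monotone g) (hρ : 0 < ρ)
    (hG : ∫⁻ x in Ioc 0 ρ, g x ≤ ENNReal.ofReal (ρ * ρ)) (hgρ : g ρ ≤ ENNReal.ofReal (2 * ρ))
    {w l : ℝ} (hw : 0 ≤ w) (hwρ : w ≤ ρ) {e : ℝ → ℝ≥0∞} (he : Measurable e)
    (hl : (∫⁻ p, e p) + ENNReal.ofReal (2 * ρ * (2 * ρ + 2 * w)) ≤ ENNReal.ofReal (2 * ρ * l)) :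
    ∃ u ∈ Ioc 0 ρ, (u ≤ w ∧ g u + g ρ + g (w - u) + (e (2 * u) + e (2 * (ρ + u))) ≤
        ENNReal.ofReal l) ∨ (w < u ∧ g u + g (ρ + w - u) + e (2 * u) ≤ ENNReal.ofReal l) := by
  have hgm := hg.measurable
  have hg1 : Measurable fun u => g (w - u) := hgm.comp (by fun_prop)
  have hg2 : Measurable fun u => g (ρ + w - u) := hgm.comp (by fun_prop)
  set F : ℝ → ℝ≥0∞ := fun u => if u ≤ w then
    g u + g ρ + g (w - u) + (e (2 * u) + e (2 * (ρ + u))) else g u + g (ρ + w - u) + e (2 * u)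
    with hF
  have hFm : Measurable F := by
    refine Measurable.ite measurableSet_Iic ?_ ?_ <;> fun_prop
  have hint : ∫⁻ u in Ioc 0 ρ, F u ≤ ENNReal.ofReal (ρ * l) := by
    have hA : ∫⁻ u in Ioc 0 w, F u = (∫⁻ u in Ioc 0 w, g u) + ENNReal.ofReal w * g ρ +
        (∫⁻ u in Ioc 0 w, g u) + ((∫⁻ u in Ioc 0 w, e (2 * u)) +
          ∫⁻ u in Ioc ρ (ρ + w), e (2 * u)) := by
      rw [setLIntegral_congr_fun (g := fun u => g u + g ρ + g (w - u) +
        (e (2 * u) + e (2 * (ρ + u)))) measurableSet_Ioc fun u hu => by simp [hF, hu.2]]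
      rw [lintegral_add_left (by fun_prop), lintegral_add_left (by fun_prop),
        lintegral_add_left (by fun_prop), lintegral_add_left (by fun_prop),
        setLIntegral_Ioc_sub_left g 0 w w, setLIntegral_const, Real.volume_Ioc,
        setLIntegral_Ioc_add_left (fun u => e (2 * u)) 0 w ρ]
      simp [mul_comm]
    have hB : ∫⁻ u in Ioc w ρ, F u = (∫⁻ u in Ioc w ρ, g u) + (∫⁻ u in Ioc w ρ, g u) +
        ∫⁻ u in Ioc w ρ, e (2 * u) := by
      rw [setLIntegral_congr_fun (g := fun u => g u + g (ρ + w - u) + e (2 * u))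
        measurableSet_Ioc fun u hu => by simp [hF, hu.1]]
      rw [lintegral_add_left (by fun_prop), lintegral_add_left (by fun_prop),
        setLIntegral_Ioc_sub_left g w ρ (ρ + w)]
      simp
    have he2 : (∫⁻ u in Ioc 0 (ρ + w), e (2 * u)) + ENNReal.ofReal (ρ * (2 * ρ + 2 * w)) ≤
        ENNReal.ofReal (ρ * l) := by
      refine (ENNReal.mul_le_mul_iff_right (a := 2) two_ne_zero ENNReal.ofNat_ne_top).1 ?_
      have h2 : ∀ x : ℝ, 2 * ENNReal.ofReal (ρ * x) = ENNReal.ofReal (2 * ρ * x) := by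
        intro x
        rw [mul_assoc, ENNReal.ofReal_mul (by norm_num : (0 : ℝ) ≤ 2)]
        simp
      rw [mul_add, h2, h2]
      refine le_trans ?_ hl
      gcongr
      rw [← lintegral_comp_two_mul he]
      gcongr
      exact Measure.restrict_le_self
    rw [← setLIntegral_Ioc_add_Ioc F hw hwρ, hA, hB]
    calc _ = ((∫⁻ u in Ioc 0 w, g u) + ∫⁻ u in Ioc w ρ, g u) +
          ((∫⁻ u in Ioc 0 w, g u) + ∫⁻ u in Ioc w ρ, g u) + ENNReal.ofReal w * g ρ +
          (((∫⁻ u in Ioc 0 w, e (2 * u)) + ∫⁻ u in Ioc w ρ, e (2 * u)) +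
            ∫⁻ u in Ioc ρ (ρ + w), e (2 * u)) := by ring
      _ = (∫⁻ u in Ioc 0 ρ, g u) + (∫⁻ u in Ioc 0 ρ, g u) + ENNReal.ofReal w * g ρ +
          ∫⁻ u in Ioc 0 (ρ + w), e (2 * u) := by
          rw [setLIntegral_Ioc_add_Ioc g hw hwρ,
            setLIntegral_Ioc_add_Ioc (fun u => e (2 * u)) hw hwρ,
            setLIntegral_Ioc_add_Ioc (fun u => e (2 * u)) hρ.le (by linarith)]
      _ ≤ ENNReal.ofReal (ρ * ρ) + ENNReal.ofReal (ρ * ρ) +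
          ENNReal.ofReal w * ENNReal.ofReal (2 * ρ) + ∫⁻ u in Ioc 0 (ρ + w), e (2 * u) := by
          gcongr
      _ = (∫⁻ u in Ioc 0 (ρ + w), e (2 * u)) + ENNReal.ofReal (ρ * (2 * ρ + 2 * w)) := by
          rw [← ENNReal.ofReal_add (by positivity) (by positivity), ← ENNReal.ofReal_mul hw,
            ← ENNReal.ofReal_add (by positivity) (by positivity), add_comm]
          congr 2
          ring
      _ ≤ _ := he2
  have hvol : volume (Ioc 0 ρ) = ENNReal.ofReal ρ := by simp
  obtain ⟨u, hu, hFu⟩ := exists_le_setLAverage (μ := volume) (s := Ioc 0 ρ) (f := F)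
    (by rw [hvol]; simpa using hρ) (by simp [hvol]) hFm.aemeasurable
  have hle : F u ≤ ENNReal.ofReal l := by
    refine hFu.trans ?_
    rw [setLAverage_eq, hvol]
    refine ENNReal.div_le_of_le_mul ?_
    rwa [mul_comm, ← ENNReal.ofReal_mul hρ.le]
  refine ⟨u, hu, ?_⟩
  rcases le_or_gt u w with huw | huw
  · exact Or.inl ⟨huw, by simpa [hF, huw] using hle⟩
  · exact Or.inr ⟨huw, by simpa [hF, not_le.2 huw] using hle⟩

/-- Two trees joined at their roots, with sum of the heights between `2ρ` and `4ρ` and of length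
at most `2ρ` each, are covered at a cost of at most their total length. -/
theorem HasSpine.coverCost_union (hN : IsLengthRel N) (hg : Monotone g) (hρ : 0 < ρ)
    (hG : ∫⁻ x in Ioc 0 ρ, g x ≤ ENNReal.ofReal (ρ * ρ)) (hgρ : g ρ ≤ ENNReal.ofReal (2 * ρ))
    {s s' : Set X} {a : X} {h h' l l' : ℝ} {γ γ' : ℝ → X} {U U' : ℝ → Set X} {d d' : ℝ → ℝ≥0∞}
    (hsp : HasSpine N g ρ s a h l γ U d) (hsp' : HasSpine N g ρ s' a h' l' γ' U' d')
    (h0 : 0 ≤ h) (h0' : 0 ≤ h') (hhl : h ≤ l) (hhl' : h' ≤ l')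
    (hl : l ≤ 2 * ρ) (hl' : l' ≤ 2 * ρ) (hh : 2 * ρ ≤ h + h') :
    CoverCost N g ρ (s ∪ s') (ENNReal.ofReal (l + l')) := by
  set D := h + h' with hD
  -- The path from one deepest leaf to the other one.
  set Γ : ℝ → X := fun p => if p ≤ h then γ p else γ' (h' - (p - h)) with hΓ
  have hΓu : IsUnitSpeed N D Γ := by
    refine hsp.unitSpeed.append (δ := fun q => γ' (h' - q)) hN ?_
      (by rw [sub_zero, hsp'.top, hsp.top])
    intro p q hp hpq hq
    exact hN.mono (hN.symm (hsp'.unitSpeed (h' - q) (h' - p) (by linarith) (by linarith)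
      (by linarith))) (by linarith)
  have hΓ' : ∀ t ∈ Icc 0 h', Γ (D - t) = γ' t := by
    intro t ht
    simp only [hΓ, hD]
    split_ifs with hc
    · obtain rfl : t = h' := le_antisymm ht.2 (by linarith)
      rw [add_sub_cancel_right, hsp.top, hsp'.top]
    · congr 1
      ring
  set V : ℝ → Set X := fun p => U p ∪ U' (D - p) with hV
  have hVc : ∀ p, CoverCost N g ρ (V p) (d p + d' (D - p)) :=
    fun p => (hsp.cover p).union (hsp'.cover (D - p))
  have hcoord : ∀ x ∈ s ∪ s', ∃ t ∈ Icc 0 D, N (Γ t) x t ∧ N (Γ t) x (D - t) ∧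
      ∀ p, x ∈ V p ∨ N (Γ t) x |p - t| := by
    rintro x (hx | hx)
    · obtain ⟨t, ht, h1, h2, h3⟩ := hsp.coord x hx
      refine ⟨t, ⟨ht.1, by linarith [ht.2]⟩, ?_⟩
      have : Γ t = γ t := by simp [hΓ, ht.2]
      rw [this]
      exact ⟨h1, hN.mono h2 (by linarith), fun p => (h3 p).imp Or.inl id⟩
    · obtain ⟨t, ht, h1, h2, h3⟩ := hsp'.coord x hx
      refine ⟨D - t, ⟨by linarith [ht.2], by linarith [ht.1]⟩, ?_⟩
      rw [hΓ' t ht]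
      refine ⟨hN.mono h2 (by linarith), hN.mono h1 (by linarith), fun p => ?_⟩
      refine (h3 (D - p)).imp Or.inr fun hn => ?_
      rwa [show p - (D - t) = -(D - p - t) by ring, abs_neg]
  have hdm := hsp.measurable
  have hdm' := hsp'.measurable
  obtain ⟨w, hw⟩ : ∃ w, D = 2 * ρ + 2 * w := ⟨(D - 2 * ρ) / 2, by ring⟩
  have hw0 : 0 ≤ w := by linarith
  have hwρ : w ≤ ρ := by linarith
  obtain ⟨u, hu, ⟨huw, hcost⟩ | ⟨huw, hcost⟩⟩ := exists_cost_le hg hρ hG hgρ (l := l + l') hw0 hwρ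
    (e := fun p => d p + d' (D - p)) (by fun_prop) (by
      rw [lintegral_add_left hdm, lintegral_sub_left_eq_self d' D, ← hw, hD, mul_add, mul_add,
        ENNReal.ofReal_add (by positivity) (by positivity),
        ENNReal.ofReal_add (mul_nonneg (by linarith) (h0.trans hhl))
          (mul_nonneg (by linarith) (h0'.trans hhl'))]
      calc _ = ((∫⁻ p, d p) + ENNReal.ofReal (2 * ρ * h)) +
            ((∫⁻ p, d' p) + ENNReal.ofReal (2 * ρ * h')) := by ring
        _ ≤ _ := add_le_add hsp.lintegral_le hsp'.lintegral_le)
  · refine (((((CoverCost.ball (s := {x | N (Γ u) x u}) hu.1.le hu.2 fun x hx => hx).union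
      (CoverCost.ball (s := {x | N (Γ (2 * u + ρ)) x ρ}) hρ.le le_rfl fun x hx => hx)).union
      (CoverCost.ball (s := {x | N (Γ (u + 2 * ρ + w)) x (w - u)}) (by linarith)
        (by linarith [hu.1]) fun x hx => hx)).union ((hVc (2 * u)).union
          (hVc (2 * (ρ + u)))))).mono ?_ hcost
    intro x hx
    obtain ⟨t, ht, h1, h2, h3⟩ := hcoord x hx
    by_cases hx1 : x ∈ V (2 * u)
    · exact Or.inr (Or.inl hx1)
    by_cases hx2 : x ∈ V (2 * (ρ + u))
    · exact Or.inr (Or.inr hx2)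
    left
    have n1 := (h3 (2 * u)).resolve_left hx1
    have n2 := (h3 (2 * (ρ + u))).resolve_left hx2
    rcases le_total t (2 * u) with c1 | c1
    · rw [abs_of_nonneg (by linarith)] at n1
      have := hΓu.near_midpoint hN le_rfl (by linarith) ht.1 c1 (by simpa using h1) n1
      left; left
      show N _ _ _
      convert this using 2 <;> ring
    · rw [abs_sub_comm, abs_of_nonneg (by linarith)] at n1
      rcases le_total t (2 * (ρ + u)) with c2 | c2
      · rw [abs_of_nonneg (by linarith)] at n2
        have := hΓu.near_midpoint hN (by linarith [hu.1]) (by linarith) c1 c2 n1 n2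
        left; right
        show N _ _ _
        convert this using 2 <;> ring
      · rw [abs_sub_comm, abs_of_nonneg (by linarith)] at n2
        have := hΓu.near_midpoint hN (by linarith [hu.1]) le_rfl c2 ht.2 n2 h2
        right
        show N _ _ _
        rw [hw] at this
        convert this using 2 <;> ring
  · refine (((CoverCost.ball (s := {x | N (Γ u) x u}) hu.1.le hu.2 fun x hx => hx).union
      (CoverCost.ball (s := {x | N (Γ (u + ρ + w)) x (ρ + w - u)}) (by linarith [hu.2])
        (by linarith) fun x hx => hx)).union (hVc (2 * u))).mono ?_ hcost
    intro x hx
    obtain ⟨t, ht, h1, h2, h3⟩ := hcoord x hx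
    by_cases hx1 : x ∈ V (2 * u)
    · exact Or.inr hx1
    left
    have n1 := (h3 (2 * u)).resolve_left hx1
    rcases le_total t (2 * u) with c1 | c1
    · rw [abs_of_nonneg (by linarith)] at n1
      have := hΓu.near_midpoint hN le_rfl (by linarith [hu.2]) ht.1 c1 (by simpa using h1) n1
      left
      show N _ _ _
      convert this using 2 <;> ring
    · rw [abs_sub_comm, abs_of_nonneg (by linarith)] at n1
      have := hΓu.near_midpoint hN (by linarith [hu.1]) le_rfl c1 ht.2 n1 h2
      right
      show N _ _ _
      rw [hw] at this
      convert this using 2 <;> ring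

/-! ### Covering a whole tree -/

namespace IsRootedTree

variable {s : Set X} {a : X} {h l : ℝ}

/-- A tree of length at most `2ρ` fits into one ball of radius `ρ`. -/
theorem coverCost_of_length_le (hN : IsLengthRel N) (hg : Monotone g) (hρ : 0 < ρ)
    (hG : ∫⁻ x in Ioc 0 ρ, g x ≤ ENNReal.ofReal (ρ * ρ)) (hgρ : g ρ ≤ ENNReal.ofReal (2 * ρ))
    (hs : IsRootedTree N s a h l) (hl : l ≤ 2 * ρ) :
    CoverCost N g ρ s (ENNReal.ofReal (2 * ρ)) := by
  obtain ⟨γ, U, d, hsp⟩ := hs.exists_hasSpine hN hg hG hρ.le hl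
  obtain ⟨v, hv⟩ := hsp.exists_ball (s' := ∅) (h' := 0) hN hρ.le (hs.near_root hN) (by simp) hl
    hs.height_nonneg (by linarith [hs.height_le_length])
  exact (CoverCost.ball hρ.le le_rfl fun x hx => hv x (Or.inl hx)).mono (subset_refl _) hgρ

/-- `HasRemainder N g ρ s a l`: all of `s` but a tree with the same root and of length less than
`2ρ` is covered at a cost of at most the difference of the lengths. -/
def HasRemainder (N : X → X → ℝ → Prop) (g : ℝ → ℝ≥0∞) (ρ : ℝ) (s : Set X) (a : X) (l : ℝ) :
    Prop :=
  ∃ (t : Set X) (h' l' c : ℝ), IsRootedTree N t a h' l' ∧ l' < 2 * ρ ∧ 0 ≤ c ∧ c + l' ≤ l ∧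
    CoverCost N g ρ (s \ t) (ENNReal.ofReal c)

/-- Growing a long edge, by induction on the number of pieces of length `2ρ` that are cut off. -/
theorem hasRemainder_grow (hN : IsLengthRel N) (hg : Monotone g) (hρ : 0 < ρ)
    (hG : ∫⁻ x in Ioc 0 ρ, g x ≤ ENNReal.ofReal (ρ * ρ)) (hgρ : g ρ ≤ ENNReal.ofReal (2 * ρ))
    (n : ℕ) (hs : IsRootedTree N s a h l) (hl : l < 2 * ρ) {L : ℝ} {γ : ℝ → X} (hL : 0 ≤ L)
    (ha : γ 0 = a) (hγ : IsUnitSpeed N L γ) (hn : l + L < 2 * ρ * (n + 1)) :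
    HasRemainder N g ρ (s ∪ γ '' Icc 0 L) (γ L) (l + L) := by
  induction n generalizing s a h l L γ with
  | zero =>
    refine ⟨_, _, _, 0, hs.grow L γ hL ha hγ, by simpa using hn, le_rfl, by simp, ?_⟩
    rw [sdiff_self]
    exact CoverCost.empty.mono (subset_refl _) zero_le
  | succ n ih =>
    by_cases hlt : l + L < 2 * ρ
    · refine ⟨_, _, _, 0, hs.grow L γ hL ha hγ, hlt, le_rfl, by simp, ?_⟩
      rw [sdiff_self]
      exact CoverCost.empty.mono (subset_refl _) zero_le
    push Not at hlt
    -- The tree grown up to length exactly `2ρ` is cut off.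
    have hb : 0 ≤ 2 * ρ - l := by linarith
    have hcov := (hs.grow (2 * ρ - l) γ hb ha (hγ.mono (by linarith))).coverCost_of_length_le
      hN hg hρ hG hgρ (by linarith)
    obtain ⟨t, h', l', c, ht, hl', hc, hcl, hct⟩ := ih (s := {γ (2 * ρ - l)})
      (L := L - (2 * ρ - l)) (γ := fun p => γ (2 * ρ - l + p)) (IsRootedTree.point _)
      (by linarith) (by linarith) (by simp) (hγ.shift hb) (by push_cast at hn; linarith)
    rw [show 2 * ρ - l + (L - (2 * ρ - l)) = L by ring] at ht
    refine ⟨t, h', l', 2 * ρ + c, ht, hl', by linarith, by linarith, ?_⟩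
    rw [ENNReal.ofReal_add (by linarith) hc]
    refine (hcov.union hct).mono ?_ le_rfl
    rintro x ⟨hx | ⟨q, hq, rfl⟩, hxt⟩
    · exact Or.inl (Or.inl hx)
    · rcases le_total q (2 * ρ - l) with hq' | hq'
      · exact Or.inl (Or.inr ⟨q, ⟨hq.1, hq'⟩, rfl⟩)
      · exact Or.inr ⟨Or.inr ⟨q - (2 * ρ - l), ⟨by linarith, by linarith [hq.2]⟩, by simp⟩, hxt⟩

/-- When two remainders are joined and their total length is at least `2ρ`, both are covered: by one
ball if the sum of their heights is at most `2ρ`, and by `HasSpine.coverCost_union` otherwise. -/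
theorem hasRemainder (hN : IsLengthRel N) (hg : Monotone g) (hρ : 0 < ρ)
    (hG : ∫⁻ x in Ioc 0 ρ, g x ≤ ENNReal.ofReal (ρ * ρ)) (hgρ : g ρ ≤ ENNReal.ofReal (2 * ρ))
    (hs : IsRootedTree N s a h l) : HasRemainder N g ρ s a l := by
  induction hs with
  | point a =>
    refine ⟨_, _, _, 0, IsRootedTree.point a, by linarith, le_rfl, by simp, ?_⟩
    rw [sdiff_self]
    exact CoverCost.empty.mono (subset_refl _) zero_le
  | @grow s a h l L γ hs hL ha hγ ih =>
    obtain ⟨t, h', l', c, ht, hl', hc, hcl, hct⟩ := ih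
    obtain ⟨n, hn⟩ := exists_nat_gt ((l' + L) / (2 * ρ))
    rw [div_lt_iff₀ (by linarith)] at hn
    obtain ⟨t₂, h₂, l₂, c₂, ht₂, hl₂, hc₂, hcl₂, hct₂⟩ :=
      hasRemainder_grow hN hg hρ hG hgρ n ht hl' hL ha hγ (by linarith)
    refine ⟨t₂, h₂, l₂, c + c₂, ht₂, hl₂, by linarith, by linarith, ?_⟩
    rw [ENNReal.ofReal_add hc hc₂]
    refine (hct.union hct₂).mono ?_ le_rfl
    rintro x ⟨hx | hx, hxt⟩
    · by_cases hxt' : x ∈ t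
      exacts [Or.inr ⟨Or.inl hxt', hxt⟩, Or.inl ⟨hx, hxt'⟩]
    · exact Or.inr ⟨Or.inr hx, hxt⟩
  | @join s s' a h1 h1' l1 l1' hs hs' ih ih' =>
    obtain ⟨t, h, l, c, ht, hl, hc, hcl, hct⟩ := ih
    obtain ⟨t', h', l', c', ht', hl', hc', hcl', hct'⟩ := ih'
    have hboth := hct.union hct'
    rw [← ENNReal.ofReal_add hc hc'] at hboth
    by_cases hlt : l + l' < 2 * ρ
    · refine ⟨t ∪ t', _, _, c + c', ht.join ht', hlt, by linarith, by linarith, hboth.mono ?_ le_rfl⟩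
      rintro x ⟨hx | hx, hxt⟩
      exacts [Or.inl ⟨hx, fun h => hxt (Or.inl h)⟩, Or.inr ⟨hx, fun h => hxt (Or.inr h)⟩]
    push Not at hlt
    have hhl := ht.height_le_length
    have hhl' := ht'.height_le_length
    have h0 := ht.height_nonneg
    have h0' := ht'.height_nonneg
    have hcov : CoverCost N g ρ (t ∪ t') (ENNReal.ofReal (l + l')) := by
      obtain ⟨γ, U, d, hsp⟩ := ht.exists_hasSpine hN hg hG hρ.le hl.le
      obtain ⟨γ', U', d', hsp'⟩ := ht'.exists_hasSpine hN hg hG hρ.le hl'.le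
      rcases le_total (2 * ρ) (h + h') with hh | hh
      · exact hsp.coverCost_union hN hg hρ hG hgρ hsp' h0 h0' hhl hhl' hl.le hl'.le hh
      · have : ∃ v, ∀ x ∈ t ∪ t', N v x ρ := by
          rcases le_total h' h with hle | hle
          · exact hsp.exists_ball hN hρ.le (ht.near_root hN) (ht'.near_root hN) hl.le hle hh
          · rw [union_comm]
            exact hsp'.exists_ball hN hρ.le (ht'.near_root hN) (ht.near_root hN) hl'.le hle
              (by linarith)
        obtain ⟨v, hv⟩ := this
        exact (CoverCost.ball hρ.le le_rfl hv).mono (subset_refl _)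
          (hgρ.trans (ENNReal.ofReal_le_ofReal hlt))
    refine ⟨{a}, 0, 0, (c + c') + (l + l'), IsRootedTree.point a, by linarith, by linarith,
      by linarith, ?_⟩
    rw [ENNReal.ofReal_add (by linarith) (by linarith)]
    refine (hboth.union hcov).mono ?_ le_rfl
    rintro x ⟨hx | hx, -⟩
    · by_cases hxt : x ∈ t
      exacts [Or.inr (Or.inl hxt), Or.inl (Or.inl ⟨hx, hxt⟩)]
    · by_cases hxt : x ∈ t'
      exacts [Or.inr (Or.inr hxt), Or.inl (Or.inr ⟨hx, hxt⟩)]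

/-- A tree of length `l` is covered at a cost of at most `l + 2ρ`. -/
theorem coverCost (hN : IsLengthRel N) (hg : Monotone g) (hρ : 0 < ρ)
    (hG : ∫⁻ x in Ioc 0 ρ, g x ≤ ENNReal.ofReal (ρ * ρ)) (hgρ : g ρ ≤ ENNReal.ofReal (2 * ρ))
    (hs : IsRootedTree N s a h l) : CoverCost N g ρ s (ENNReal.ofReal (l + 2 * ρ)) := by
  obtain ⟨t, h', l', c, ht, hl', hc, hcl, hct⟩ := hs.hasRemainder hN hg hρ hG hgρ
  have h0 := ht.height_nonneg.trans ht.height_le_length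
  refine (hct.union (ht.coverCost_of_length_le hN hg hρ hG hgρ hl'.le)).mono ?_ ?_
  · intro x hx
    by_cases hxt : x ∈ t
    exacts [Or.inr hxt, Or.inl ⟨hx, hxt⟩]
  · rw [← ENNReal.ofReal_add hc (by linarith)]
    exact ENNReal.ofReal_le_ofReal (by linarith)

end IsRootedTree

end

/-! ### Metric trees as rooted trees -/

namespace MetricTree

variable {T : MetricTree.{u}}

theorem HasPath.nonneg {x y : T.Point} {L : ℝ} (h : T.HasPath x y L) : 0 ≤ L := by
  induction h with
  | refl => exact le_rfl
  | step d s t L _ ih => positivity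

theorem HasPath.trans {x y z : T.Point} {L L' : ℝ} (h : T.HasPath x y L)
    (h' : T.HasPath y z L') : T.HasPath x z (L + L') := by
  induction h' with
  | refl => simpa using h
  | step d s t L' _ ih =>
    rw [← add_assoc]
    exact HasPath.step d s t _ ih

theorem hasPath_onEdge (d : T.graph.Dart) (s t : Icc (0 : ℝ) (T.dartLen d)) :
    T.HasPath (T.onEdge d s) (T.onEdge d t) |(t : ℝ) - s| := by
  simpa using HasPath.step (T := T) d s t 0 HasPath.refl

theorem HasPath.symm {x y : T.Point} {L : ℝ} (h : T.HasPath x y L) : T.HasPath y x L := by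
  induction h with
  | refl => exact HasPath.refl
  | step d s t L _ ih =>
    rw [add_comm, abs_sub_comm]
    exact (hasPath_onEdge d t s).trans ih

/-- The points `x` and `y` are joined by a path of length at most `L`. -/
def Near (T : MetricTree.{u}) (x y : T.Point) (L : ℝ) : Prop := ∃ L' ≤ L, T.HasPath x y L'

theorem isLengthRel_near (T : MetricTree.{u}) : IsLengthRel T.Near where
  refl _ := ⟨0, le_rfl, HasPath.refl⟩
  mono := fun ⟨L', h, hp⟩ hL => ⟨L', h.trans hL, hp⟩
  symm := fun ⟨L', h, hp⟩ => ⟨L', h, hp.symm⟩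
  trans := fun ⟨L₁, h₁, hp₁⟩ ⟨L₂, h₂, hp₂⟩ => ⟨L₁ + L₂, add_le_add h₁ h₂, hp₁.trans hp₂⟩

theorem Near.mem_closedBall {x y : T.Point} {L : ℝ} (h : T.Near x y L) :
    y ∈ T.closedBall x L := by
  obtain ⟨L', hL, hp⟩ := h
  exact (csInf_le ⟨0, fun _ hq => HasPath.nonneg hq⟩ hp).trans hL

theorem isCover_of_near {R : RadiiSeq} (hR : ∀ i, 0 ≤ R.2 i)
    (h : ∃ v : Fin R.1 → T.Point, ∀ x, ∃ i, T.Near (v i) x (R.2 i)) : T.IsCover R := by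
  obtain ⟨v, hv⟩ := h
  refine ⟨hR, v, eq_univ_of_forall fun x => ?_⟩
  obtain ⟨i, hi⟩ := hv x
  exact mem_iUnion.2 ⟨i, hi.mem_closedBall⟩

theorem dartLen_pos (d : T.graph.Dart) : 0 < T.dartLen d := T.len_pos _

/-- The edge underlying a dart, run through at unit speed from its initial to its final vertex. -/
noncomputable def edgeCurve (T : MetricTree.{u}) (d : T.graph.Dart) (t : ℝ) : T.Point :=
  T.onEdge d (projIcc 0 (T.dartLen d) (dartLen_pos d).le t)

theorem edgeCurve_zero (d : T.graph.Dart) : T.edgeCurve d 0 = T.vertex d.fst := by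
  rw [edgeCurve, projIcc_left]
  exact Quot.sound (Glue.start d _ rfl)

theorem edgeCurve_dartLen (d : T.graph.Dart) :
    T.edgeCurve d (T.dartLen d) = T.vertex d.snd := by
  rw [edgeCurve, projIcc_right]
  have h0 : (0 : ℝ) ∈ Icc 0 (T.dartLen d.symm) := ⟨le_rfl, (dartLen_pos _).le⟩
  exact (Quot.sound (Glue.flip d _ ⟨0, h0⟩ (by simp))).trans
    (Quot.sound (Glue.start d.symm _ rfl))

theorem isUnitSpeed_edgeCurve (d : T.graph.Dart) :
    IsUnitSpeed T.Near (T.dartLen d) (T.edgeCurve d) := by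
  intro p q hp hpq hq
  refine ⟨_, le_of_eq ?_, hasPath_onEdge d _ _⟩
  rw [projIcc_of_mem _ ⟨hp, hpq.trans hq⟩, projIcc_of_mem _ ⟨hp.trans hpq, hq⟩]
  exact abs_of_nonneg (sub_nonneg.2 hpq)

/-- The points of the edge underlying a dart. -/
def edgePoints (T : MetricTree.{u}) (d : T.graph.Dart) : Set T.Point := range (T.onEdge d)

theorem image_edgeCurve (d : T.graph.Dart) :
    T.edgeCurve d '' Icc 0 (T.dartLen d) = T.edgePoints d := by
  ext x
  constructor
  · rintro ⟨t, -, rfl⟩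
    exact ⟨_, rfl⟩
  · rintro ⟨t, rfl⟩
    exact ⟨t, t.2, by rw [edgeCurve, projIcc_val]⟩

theorem edgePoints_symm_subset (d : T.graph.Dart) : T.edgePoints d ⊆ T.edgePoints d.symm := by
  rintro _ ⟨t, rfl⟩
  have hlen : T.dartLen d.symm = T.dartLen d := by simp [dartLen]
  refine ⟨⟨T.dartLen d - t, ?_, ?_⟩, ?_⟩
  · exact sub_nonneg.2 t.2.2
  · rw [hlen]
    linarith [t.2.1]
  · exact (Quot.sound (Glue.flip d t _ (by simp))).symm

theorem edgePoints_eq_of_edge_eq {d d' : T.graph.Dart} (h : d.edge = d'.edge) :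
    T.edgePoints d = T.edgePoints d' := by
  have hs : T.edgePoints d'.symm = T.edgePoints d' :=
    subset_antisymm (by simpa using edgePoints_symm_subset d'.symm) (edgePoints_symm_subset d')
  rcases SimpleGraph.dart_edge_eq_iff d d' |>.1 h with rfl | rfl
  exacts [rfl, hs]

theorem vertex_fst_mem (d : T.graph.Dart) : T.vertex d.fst ∈ T.edgePoints d := by
  rw [← edgeCurve_zero]; exact ⟨_, rfl⟩

theorem isRootedTree_edge (d : T.graph.Dart) :
    IsRootedTree T.Near (T.edgePoints d) (T.vertex d.snd) (T.dartLen d) (T.dartLen d) := by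
  have := (IsRootedTree.point (N := T.Near) (T.vertex d.fst)).grow (T.dartLen d) (T.edgeCurve d)
    (dartLen_pos d).le (edgeCurve_zero d) (isUnitSpeed_edgeCurve d)
  rw [image_edgeCurve, edgeCurve_dartLen, zero_add] at this
  rwa [union_eq_self_of_subset_left (singleton_subset_iff.2 (vertex_fst_mem d))] at this

/-- A metric tree is a rooted tree: its edges are attached one after the other. Lengths of paths are
only ever bounded from above, so that connectedness of the graph is all that is used. -/
theorem exists_isRootedTree (T : MetricTree.{u}) :
    ∃ (a : T.Point) (h : ℝ), IsRootedTree T.Near univ a h T.length := by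
  classical
  have := T.finite_V
  have : Finite T.graph.edgeSet := inferInstance
  have := Fintype.ofFinite T.graph.edgeSet
  obtain ⟨v₀⟩ := T.isTree.connected.nonempty
  let P : Finset T.graph.edgeSet → Prop := fun F => ∃ (s : Set T.Point) (h : ℝ),
    IsRootedTree T.Near s (T.vertex v₀) h (∑ e ∈ F, T.len e) ∧ T.vertex v₀ ∈ s ∧
    ∀ d : T.graph.Dart, (⟨d.edge, d.edge_mem⟩ : T.graph.edgeSet) ∈ F → T.edgePoints d ⊆ s
  have h0 : P ∅ := ⟨{T.vertex v₀}, 0, by simpa using IsRootedTree.point _, rfl, by simp⟩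
  obtain ⟨F, hF, hmax⟩ := (Set.toFinite {F | P F}).exists_maximal ⟨∅, h0⟩
  obtain ⟨s, h, hs, hv₀, hFs⟩ := hF
  -- By maximality all edges at the vertices of `s` are in `F`.
  have hclosed : ∀ d : T.graph.Dart, T.vertex d.snd ∈ s →
      (⟨d.edge, d.edge_mem⟩ : T.graph.edgeSet) ∈ F := by
    intro d hd
    by_contra hdF
    obtain ⟨h', H⟩ := (isRootedTree_edge d).attach hs hd
    have hP : P (insert ⟨d.edge, d.edge_mem⟩ F) := by
      refine ⟨s ∪ T.edgePoints d, h', ?_, Or.inl hv₀, ?_⟩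
      · rw [Finset.sum_insert hdF, add_comm]
        exact H
      · intro d' hd'
        rcases Finset.mem_insert.1 hd' with he | he
        · rw [edgePoints_eq_of_edge_eq (congrArg Subtype.val he)]
          exact subset_union_right
        · exact (hFs d' he).trans subset_union_left
    exact hdF (hmax hP (Finset.subset_insert _ _) (Finset.mem_insert_self _ _))
  have hvert : ∀ v, T.vertex v ∈ s := by
    intro v
    obtain ⟨p⟩ := T.isTree.connected.preconnected v v₀
    induction p with
    | nil => exact hv₀
    | @cons u v w huv p ih =>
      exact hFs ⟨(u, v), huv⟩ (hclosed ⟨(u, v), huv⟩ (ih h0 hmax hs hv₀))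
        (vertex_fst_mem ⟨(u, v), huv⟩)
  have hall : ∀ d : T.graph.Dart, (⟨d.edge, d.edge_mem⟩ : T.graph.edgeSet) ∈ F :=
    fun d => hclosed d (hvert _)
  have hFu : F = Finset.univ := by
    refine Finset.eq_univ_iff_forall.2 ?_
    rintro ⟨e, he⟩
    induction e using Sym2.ind with
    | _ x y => exact hall ⟨(x, y), he⟩
  have hsu : s = univ := by
    refine eq_univ_of_forall fun x => ?_
    induction x using Quot.ind with
    | _ x =>
      rcases x with v | ⟨d, t⟩
      · exact hvert v
      · exact hFs d (hall d) ⟨t, rfl⟩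
  refine ⟨T.vertex v₀, h, ?_⟩
  rw [length, finsum_eq_sum_of_fintype, ← hFu, ← hsu]
  exact hs

end MetricTree

/-! ### Covers with radii in prescribed cells -/

theorem List.sum_map_ofReal {α : Type*} (B : List α) (f : α → ℝ) (hf : ∀ b, 0 ≤ f b) :
    (B.map fun b => ENNReal.ofReal (f b)).sum = ENNReal.ofReal (B.map f).sum := by
  induction B with
  | nil => simp
  | cons b B ih =>
    rw [List.map_cons, List.sum_cons, ih, List.map_cons, List.sum_cons,
      ENNReal.ofReal_add (hf b) (List.sum_nonneg (by simpa using fun a _ => hf a))]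

/-- The integral of a step function with value `w i` on `((i - 1) δ, i δ]`. -/
theorem setLIntegral_step_le {δ : ℝ} (hδ : 0 < δ) {w : ℕ → ℝ} (hw : ∀ i, 0 ≤ w i) (j : ℕ) :
    ∫⁻ x in Ioc 0 (j * δ), ENNReal.ofReal (w ⌈x / δ⌉₊) ≤
      ENNReal.ofReal (δ * ∑ i ∈ Finset.range j, w (i + 1)) := by
  induction j with
  | zero => simp
  | succ j ih =>
    rw [← setLIntegral_Ioc_add_Ioc _ (b := j * δ) (by positivity) (by push_cast; linarith),
      Finset.sum_range_succ, mul_add, ENNReal.ofReal_add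
        (mul_nonneg hδ.le (Finset.sum_nonneg fun i _ => hw _)) (mul_nonneg hδ.le (hw _))]
    gcongr
    rw [setLIntegral_congr_fun (g := fun _ => ENNReal.ofReal (w (j + 1))) measurableSet_Ioc]
    · rw [setLIntegral_const, Real.volume_Ioc, mul_comm, ← ENNReal.ofReal_mul (by
        push_cast; linarith)]
      refine le_of_eq ?_
      congr 1
      push_cast
      ring
    · intro x hx
      have : ⌈x / δ⌉₊ = j + 1 := by
        rw [Nat.ceil_eq_iff (by simp)]
        refine ⟨?_, ?_⟩
        · rw [lt_div_iff₀ hδ]; simpa using hx.1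
        · rw [div_le_iff₀ hδ]; exact hx.2
      simp only [this]

/-- A choice of an index `m i ≥ i` of least weight. Replacing the weight of `i` by that of `m i`
makes the weights monotone. The argument `i` is a natural number, and values above `n` are junk. -/
theorem exists_suffix_argmin {n : ℕ} (W : Fin (n + 1) → ℝ) :
    ∃ m : ℕ → Fin (n + 1), (∀ i ≤ n, i ≤ m i) ∧ (∀ i j, i ≤ j → W (m i) ≤ W (m j)) ∧
      ∀ (i : ℕ) (k : Fin (n + 1)), i ≤ k → W (m i) ≤ W k := by
  have hne : ∀ i : ℕ, (Finset.univ.filter fun k : Fin (n + 1) => min i n ≤ k).Nonempty :=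
    fun i => ⟨Fin.last n, by simp⟩
  choose m hm hmin using fun i => Finset.exists_min_image _ W (hne i)
  simp only [Finset.mem_filter, Finset.mem_univ, true_and] at hm hmin
  refine ⟨m, fun i hi => ?_, fun i j hij => hmin i _ (le_trans ?_ (hm j)), fun i k hik =>
    hmin i k ((min_le_left _ _).trans hik)⟩
  · simpa [hi] using hm i
  · exact min_le_min_right _ hij

/-- Every sequence of radii in which the `i`-th one is at least `K i * δ` is a cover. -/
def MetricTree.CoversFrom (T : MetricTree.{u}) (δ : ℝ) {m n : ℕ} (K : Fin m → Fin n) : Prop :=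
  ∀ R : Fin m → ℝ, (∀ i, (K i : ℕ) * δ ≤ R i) →
    ∃ v : Fin m → T.Point, ∀ x, ∃ i, T.Near (v i) x (R i)

/-- For any weights on the cells `[k δ, (k + 1) δ)` with `k ≤ n` there are a cover and a choice of a
cell above each of its radii with total weight at most `(|T| + 2nδ) / (n² δ)` times the sum of the
weights. -/
theorem MetricTree.exists_coversFrom (T : MetricTree.{u}) {δ : ℝ} (hδ : 0 < δ) {n : ℕ}
    (hn : 0 < n) (W : Fin (n + 1) → ℝ) (hW : ∀ k, 0 ≤ W k) :
    ∃ (m : ℕ) (K : Fin m → Fin (n + 1)), T.CoversFrom δ K ∧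
      ∑ i, W (K i) ≤ (T.length + 2 * (n * δ)) / (n ^ 2 * δ) * ∑ k, W k := by
  obtain ⟨a, h, hT⟩ := T.exists_isRootedTree
  obtain ⟨m, hm, hmono, hmin⟩ := exists_suffix_argmin W
  have hn' : (0 : ℝ) < n := by exact_mod_cast hn
  have hl : 0 ≤ T.length := hT.height_nonneg.trans hT.height_le_length
  set κ : ℝ := n ^ 2 * δ / ∑ k, W k with hκ
  have hS : 0 ≤ ∑ k, W k := Finset.sum_nonneg fun k _ => hW k
  have hκ0 : 0 ≤ κ := by positivity
  set w : ℕ → ℝ := fun i => κ * W (m i) with hw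
  have hw0 : ∀ i, 0 ≤ w i := fun i => mul_nonneg hκ0 (hW _)
  have hwmono : Monotone w := fun i j hij => mul_le_mul_of_nonneg_left (hmono i j hij) hκ0
  have hsum : δ * ∑ i ∈ Finset.range n, w (i + 1) ≤ (n * δ) ^ 2 := by
    have h1 : ∑ i ∈ Finset.range n, w (i + 1) ≤ κ * ∑ k, W k := by
      rw [Finset.sum_range, ← Finset.mul_sum, Fin.sum_univ_succ]
      refine mul_le_mul_of_nonneg_left ?_ hκ0
      refine le_add_of_nonneg_of_le (hW 0) (Finset.sum_le_sum fun i _ => ?_)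
      exact hmin _ _ (by simp)
    have h2 : κ * ∑ k, W k ≤ n ^ 2 * δ := by
      rcases hS.eq_or_lt with h0 | h0
      · rw [← h0, mul_zero]
        positivity
      · rw [hκ, div_mul_cancel₀ _ h0.ne']
    nlinarith
  -- The least `j` for which the average cost up to `ρ = j δ` is at most `ρ`; by minimality, the
  -- cost of radius `ρ` is at most `2ρ`.
  have hex : ∃ j : ℕ, 0 < j ∧ δ * ∑ i ∈ Finset.range j, w (i + 1) ≤ (j * δ) ^ 2 := ⟨n, hn, hsum⟩
  classical
  set j := Nat.find hex with hj
  obtain ⟨hj0, hjsum⟩ := Nat.find_spec hex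
  have hjn : j ≤ n := Nat.find_min' hex ⟨hn, hsum⟩
  rw [← hj] at hj0 hjsum
  have hj0' : (0 : ℝ) < j := by exact_mod_cast hj0
  have hwj : w j ≤ 2 * (j * δ) := by
    obtain ⟨i, hi⟩ : ∃ i, j = i + 1 := ⟨j - 1, by omega⟩
    have hprev : (i * δ) ^ 2 ≤ δ * ∑ k ∈ Finset.range i, w (k + 1) := by
      rcases Nat.eq_zero_or_pos i with h0 | h0
      · simp [h0]
      · have := Nat.find_min hex (m := i) (by omega)
        push Not at this
        exact (this h0).le
    rw [hi, Finset.sum_range_succ] at hjsum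
    rw [hi]
    push_cast at hjsum ⊢
    have : δ * w (i + 1) ≤ δ * (2 * ((i + 1) * δ)) := by nlinarith [sq_nonneg δ]
    exact le_of_mul_le_mul_left this hδ
  set g : ℝ → ℝ≥0∞ := fun y => ENNReal.ofReal (w ⌈y / δ⌉₊) with hg
  have hgmono : Monotone g := fun x y hxy =>
    ENNReal.ofReal_le_ofReal (hwmono (Nat.ceil_mono (div_le_div_of_nonneg_right hxy hδ.le)))
  obtain ⟨B, hB, hBc, hBs⟩ := hT.coverCost T.isLengthRel_near (ρ := j * δ) hgmono (by positivity)
    ((setLIntegral_step_le hδ hw0 j).trans (ENNReal.ofReal_le_ofReal (by rw [← sq]; exact hjsum)))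
    (by
      simp only [hg]
      rw [mul_div_assoc, div_self hδ.ne', mul_one, Nat.ceil_natCast]
      exact ENNReal.ofReal_le_ofReal hwj)
  refine ⟨B.length, fun i => m ⌈B[i].2 / δ⌉₊, ?_, ?_⟩
  · intro R hR
    refine ⟨fun i => B[i].1, fun x => ?_⟩
    obtain ⟨b, hb, hbx⟩ := hBc x (mem_univ x)
    obtain ⟨i, hi, rfl⟩ := List.getElem_of_mem hb
    refine ⟨⟨i, hi⟩, T.isLengthRel_near.mono hbx (le_trans ?_ (hR ⟨i, hi⟩))⟩
    have h1 : ⌈B[i].2 / δ⌉₊ ≤ n := by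
      refine le_trans (Nat.ceil_le.2 ?_) hjn
      rw [div_le_iff₀ hδ]
      exact (hB _ hb).2
    have h2 : B[i].2 / δ ≤ m ⌈B[i].2 / δ⌉₊ :=
      (Nat.le_ceil _).trans (by exact_mod_cast hm _ h1)
    rw [div_le_iff₀ hδ] at h2
    exact h2
  · have h1 : (B.map fun b => w ⌈b.2 / δ⌉₊).sum = κ * ∑ i : Fin B.length, W (m ⌈B[i].2 / δ⌉₊) := by
      rw [Finset.mul_sum]
      exact (Fin.sum_univ_fun_getElem B fun b => w ⌈b.2 / δ⌉₊).symm
    simp only [hg] at hBs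
    rw [List.sum_map_ofReal B (fun b => w ⌈b.2 / δ⌉₊) fun b => hw0 _, h1,
      ENNReal.ofReal_le_ofReal_iff (by positivity)] at hBs
    have hjn' : (j : ℝ) ≤ n := by exact_mod_cast hjn
    rcases hS.eq_or_lt with h0 | h0
    · have hz : ∀ k, W k = 0 := fun k =>
        (Finset.sum_eq_zero_iff_of_nonneg fun k _ => hW k).1 h0.symm k (Finset.mem_univ k)
      simp [hz]
    · have h2 : κ * ∑ i : Fin B.length, W (m ⌈B[i].2 / δ⌉₊) ≤ T.length + 2 * (n * δ) :=
        hBs.trans (by gcongr)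
      rw [hκ, div_mul_eq_mul_div, div_le_iff₀ h0] at h2
      rw [div_mul_eq_mul_div, le_div_iff₀ (by positivity), mul_comm]
      exact h2

/-! ### Separation -/

/-- If for all non-negative weights some vector in `S` has weighted sum at most `c` times the sum
of the weights, then the convex hull of `S` contains a vector with all coordinates below any
`c' > c`. -/
theorem exists_mem_convexHull_lt {κ : Type*} [Fintype κ] {S : Set (κ → ℝ)} {c c' : ℝ}
    (hc : c < c') (hS : ∀ W : κ → ℝ, (∀ k, 0 ≤ W k) → ∃ z ∈ S, ∑ k, z k * W k ≤ c * ∑ k, W k) :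
    ∃ z ∈ convexHull ℝ S, ∀ k, z k < c' := by
  classical
  by_contra! hcon
  have hO : {z : κ → ℝ | ∀ k, z k < c'} = Set.pi univ fun _ => Iio c' := by
    ext z; simp
  obtain ⟨f, u, hf1, hf2⟩ := geometric_hahn_banach_open (s := {z : κ → ℝ | ∀ k, z k < c'})
    (by rw [hO]; exact convex_pi fun _ _ => convex_Iio c')
    (by rw [hO]; exact isOpen_set_pi finite_univ fun _ _ => isOpen_Iio)
    (convex_convexHull ℝ S) (by
      rw [Set.disjoint_left]
      intro z hz hz'
      obtain ⟨k, hk⟩ := hcon z hz'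
      exact absurd (hz k) (not_lt_of_ge hk))
  have hfz : ∀ z : κ → ℝ, f z = ∑ k, z k * f (Pi.single k 1) := by
    intro z
    conv_lhs => rw [pi_eq_sum_univ' z, map_sum]
    exact Finset.sum_congr rfl fun k _ => by rw [map_smul, smul_eq_mul]
  have hW : ∀ k, 0 ≤ f (Pi.single k 1) := by
    intro k
    by_contra! hk
    set b : κ → ℝ := fun _ => c' - 1
    set t : ℝ := |u - f b| / -f (Pi.single k 1)
    have ht : 0 ≤ t := div_nonneg (abs_nonneg _) (by linarith)
    have hmem := hf1 (b - t • Pi.single k 1) fun i => by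
      have h1 : 0 ≤ t * (Pi.single k 1 : κ → ℝ) i := by
        refine mul_nonneg ht ?_
        rw [Pi.single_apply]
        split_ifs <;> norm_num
      simp only [b, Pi.sub_apply, Pi.smul_apply, smul_eq_mul]
      linarith
    rw [map_sub, map_smul, smul_eq_mul] at hmem
    have h2 : t * f (Pi.single k 1) = -|u - f b| := by
      simp only [t]
      rw [div_neg, neg_mul, div_mul_cancel₀ _ hk.ne]
    rw [h2] at hmem
    linarith [le_abs_self (u - f b)]
  obtain ⟨z, hz, hzc⟩ := hS _ hW
  have h1 := hf2 z (subset_convexHull ℝ S hz)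
  have h2 := hf1 (fun _ => (c + c') / 2) fun _ => by linarith
  rw [hfz] at h1 h2
  rw [← Finset.mul_sum] at h2
  have h3 : 0 ≤ ∑ k, f (Pi.single k 1) := Finset.sum_nonneg fun k _ => hW k
  nlinarith

/-! ### Trimming a sequence of radii -/

/-- The least number of terms of `R 0, …, R (m - 1)` with sum at least `l`, and `m` if there is
no such number. -/
noncomputable def trimLength (l : ℝ) (m : ℕ) (R : ℕ → ℝ) : ℕ :=
  open Classical in
  Nat.find (p := fun k => m ≤ k ∨ l ≤ ∑ i ∈ Finset.range k, R i) ⟨m, Or.inl le_rfl⟩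

/-- The shortest initial segment of `R 0, …, R (m - 1)` with sum at least `l`, and the whole
sequence if there is no such segment. -/
noncomputable def trim (l : ℝ) (m : ℕ) (R : ℕ → ℝ) : RadiiSeq :=
  ⟨trimLength l m R, fun i => R i⟩

section

variable {l : ℝ} {m : ℕ} {R : ℕ → ℝ}

theorem trimLength_le : trimLength l m R ≤ m := by
  classical
  exact Nat.find_min' _ (Or.inl le_rfl)

theorem trimLength_spec :
    trimLength l m R = m ∨ l ≤ ∑ i ∈ Finset.range (trimLength l m R), R i := by
  classical
  have h := Nat.find_spec (p := fun k => m ≤ k ∨ l ≤ ∑ i ∈ Finset.range k, R i) ⟨m, Or.inl le_rfl⟩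
  rcases h with h | h
  · exact Or.inl (le_antisymm trimLength_le h)
  · right
    unfold trimLength
    convert h

theorem sum_trim_le {r : ℝ} (hl : 0 ≤ l) (hr : 0 ≤ r) (hR : ∀ i < m, R i ≤ r) :
    ∑ i ∈ Finset.range (trimLength l m R), R i ≤ l + r := by
  classical
  rcases Nat.eq_zero_or_pos (trimLength l m R) with h0 | h0
  · rw [h0, Finset.sum_range_zero]
    positivity
  · obtain ⟨k, hk⟩ : ∃ k, trimLength l m R = k + 1 := ⟨_, (Nat.succ_pred_eq_of_pos h0).symm⟩
    have h1 : k < trimLength l m R := by omega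
    have h2 := Nat.find_min (p := fun k => m ≤ k ∨ l ≤ ∑ i ∈ Finset.range k, R i)
      ⟨m, Or.inl le_rfl⟩ (m := k) (by unfold trimLength at h1; convert h1)
    push Not at h2
    rw [hk, Finset.sum_range_succ]
    exact add_le_add h2.2.le (hR k h2.1)

theorem measurable_trimLength : Measurable (trimLength l m) := by
  classical
  unfold trimLength
  convert measurable_find (p := fun (R : ℕ → ℝ) k => m ≤ k ∨ l ≤ ∑ i ∈ Finset.range k, R i)
    (fun R => ⟨m, Or.inl le_rfl⟩) fun k => ?_
  have : MeasurableSet {R : ℕ → ℝ | l ≤ ∑ i ∈ Finset.range k, R i} :=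
    measurableSet_le measurable_const (Finset.measurable_sum _ fun i _ => measurable_pi_apply i)
  exact (MeasurableSet.const _).union this

theorem measurable_trim : Measurable (trim l m) := by
  intro s hs
  have hs' : ∀ k : ℕ, MeasurableSet ((fun f : Fin k → ℝ => (⟨k, f⟩ : RadiiSeq)) ⁻¹' s) :=
    fun k => MeasurableSpace.measurableSet_iInf.1 hs k
  have : trim l m ⁻¹' s = ⋃ k : ℕ, trimLength l m ⁻¹' {k} ∩
      (fun (R : ℕ → ℝ) (i : Fin k) => R i) ⁻¹' ((fun f : Fin k → ℝ => (⟨k, f⟩ : RadiiSeq)) ⁻¹' s) := by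
    ext R
    simp only [mem_preimage, mem_iUnion, mem_inter_iff, mem_singleton_iff]
    constructor
    · exact fun h => ⟨_, rfl, h⟩
    · rintro ⟨k, rfl, h⟩
      exact h
  rw [this]
  refine MeasurableSet.iUnion fun k => ?_
  refine (measurable_trimLength (measurableSet_singleton k)).inter ?_
  exact (measurable_pi_lambda _ fun i => measurable_pi_apply _) (hs' k)

theorem count_trim_le (B : Set ℝ) :
    (RadiiSeq.count B (trim l m R) : ℝ≥0∞) ≤
      ∑ i : Fin m, B.indicator (fun _ => (1 : ℝ≥0∞)) (R i) := by
  rw [RadiiSeq.count_eq_sum, Fin.sum_univ_eq_sum_range (fun i => B.indicator (fun _ => 1) (R i)) m]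
  refine le_trans (le_of_eq (Fin.sum_univ_eq_sum_range
    (fun i => B.indicator (fun _ => (1 : ℝ≥0∞)) (R i)) (trimLength l m R))) ?_
  exact Finset.sum_le_sum_of_subset (Finset.range_mono trimLength_le)

/-- Trimming a cover at the length of the tree leaves a good cover: by
`IsRootedTree.exists_cover_of_length_le_sum`, radii with sum at least the length always cover. -/
theorem trim_mem_goodCovers {T : MetricTree.{u}} {r : ℝ} (hT : 0 < T.length) (hr : 0 ≤ r)
    (h0 : ∀ i < m, 0 ≤ R i) (hR : ∀ i < m, R i ≤ r)
    (hcov : ∃ v : Fin m → T.Point, ∀ x, ∃ i, T.Near (v i) x (R i)) :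
    trim T.length m R ∈ T.goodCovers r := by
  have h0' : ∀ i : Fin (trimLength T.length m R), 0 ≤ R i :=
    fun i => h0 i (i.2.trans_le trimLength_le)
  refine ⟨MetricTree.isCover_of_near h0' ?_, ?_⟩
  · rcases trimLength_spec (l := T.length) (m := m) (R := R) with h | h
    · change ∃ v : Fin (trimLength T.length m R) → T.Point, ∀ x, ∃ i, T.Near (v i) x (R i)
      rw [h]
      exact hcov
    · obtain ⟨a, h', hT'⟩ := T.exists_isRootedTree
      have hk : 0 < trimLength T.length m R := by
        rcases Nat.eq_zero_or_pos (trimLength T.length m R) with hz | hz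
        · rw [hz, Finset.sum_range_zero] at h
          linarith
        · exact hz
      rw [← Fin.sum_univ_eq_sum_range] at h
      obtain ⟨v, hv⟩ := hT'.exists_cover_of_length_le_sum T.isLengthRel_near hk
        (fun i => R i) h0' h
      exact ⟨v, fun x => hv x (mem_univ x)⟩
  · refine le_trans (le_of_eq ?_) (sum_trim_le (m := m) (R := R) hT.le hr hR)
    exact Fin.sum_univ_eq_sum_range (fun i => R i) (trimLength T.length m R)

end

/-! ### Random radii -/

/-- The uniform probability measure on the cell `[k δ, (k + 1) δ)`. -/
noncomputable def cellMeasure (δ : ℝ) (k : ℕ) : Measure ℝ :=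
  ProbabilityTheory.cond volume (Ico (k * δ) ((k + 1) * δ))

theorem isProbabilityMeasure_cellMeasure {δ : ℝ} (hδ : 0 < δ) (k : ℕ) :
    IsProbabilityMeasure (cellMeasure δ k) := by
  refine ProbabilityTheory.cond_isProbabilityMeasure_of_finite ?_ ?_
  · rw [Real.volume_Ico]
    simp only [ne_eq, ENNReal.ofReal_eq_zero, not_le]
    linarith
  · simp [Real.volume_Ico]

/-- Independent radii, uniformly distributed in cells whose lower ends are the radii of a cover,
give a random good cover after trimming. -/
theorem exists_measure_of_coversFrom {T : MetricTree.{u}} {r δ : ℝ} (hT : 0 < T.length)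
    (hδ : 0 < δ) {m n : ℕ} (hn : n * δ ≤ r) {K : Fin m → Fin n} (hK : T.CoversFrom δ K) :
    ∃ ν : Measure (T.goodCovers r), IsProbabilityMeasure ν ∧ ∀ B, MeasurableSet B →
      ∫⁻ R : T.goodCovers r, (RadiiSeq.count B R : ℝ≥0∞) ∂ν ≤ ∑ i, cellMeasure δ (K i) B := by
  have hp : ∀ k, IsProbabilityMeasure (cellMeasure δ k) := isProbabilityMeasure_cellMeasure hδ
  have hr : 0 ≤ r := le_trans (by positivity) hn
  -- Projecting to the cells changes nothing on the support of the measure.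
  set Φ : (Fin m → ℝ) → ℕ → ℝ := fun R i => if h : i < m then
    max (K ⟨i, h⟩ * δ) (min (R ⟨i, h⟩) ((K ⟨i, h⟩ + 1) * δ)) else 0 with hΦ
  have hΦi : ∀ R (i : Fin m), Φ R i = max (K i * δ) (min (R i) ((K i + 1) * δ)) := by
    intro R i
    simp [hΦ]
  have hlow : ∀ R (i : Fin m), K i * δ ≤ Φ R i := fun R i => by
    rw [hΦi]; exact le_max_left _ _
  have hhigh : ∀ R (i : Fin m), Φ R i ≤ r := fun R i => by
    rw [hΦi]
    have h1 : ((K i : ℕ) + 1 : ℝ) ≤ n := by exact_mod_cast (K i).2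
    have h2 : ((K i : ℕ) + 1 : ℝ) * δ ≤ r := le_trans (by gcongr) hn
    exact max_le (le_trans (by gcongr; linarith) h2) ((min_le_right _ _).trans h2)
  have hmeas : Measurable Φ := by
    refine measurable_pi_lambda _ fun i => ?_
    by_cases h : i < m
    · simp only [hΦ, h, dite_true]
      fun_prop
    · simp only [hΦ, h, dite_false]
      fun_prop
  have hgood : ∀ R, trim T.length m (Φ R) ∈ T.goodCovers r := fun R =>
    trim_mem_goodCovers hT hr
      (fun i hi => le_trans (by positivity) (hlow R ⟨i, hi⟩)) (fun i hi => hhigh R ⟨i, hi⟩)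
      (hK (fun i => Φ R i) fun i => hlow R i)
  have hΨ : Measurable fun R => (⟨trim T.length m (Φ R), hgood R⟩ : T.goodCovers r) :=
    (measurable_trim.comp hmeas).subtype_mk
  refine ⟨(Measure.pi fun i => cellMeasure δ (K i)).map _,
    Measure.isProbabilityMeasure_map hΨ.aemeasurable, fun B hB => ?_⟩
  rw [lintegral_map (f := fun R : T.goodCovers r => (RadiiSeq.count B R : ℝ≥0∞))
    ((RadiiSeq.measurable_count hB).comp measurable_subtype_coe) hΨ]
  calc _ ≤ ∫⁻ R, ∑ i : Fin m, B.indicator (fun _ => (1 : ℝ≥0∞)) (Φ R i)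
        ∂(Measure.pi fun i => cellMeasure δ (K i)) := lintegral_mono fun R => count_trim_le B
    _ = ∑ i : Fin m, cellMeasure δ (K i) B := by
        have hind : Measurable (B.indicator fun _ => (1 : ℝ≥0∞)) := measurable_const.indicator hB
        have hcomp : ∀ i : Fin m, Measurable fun R : Fin m → ℝ =>
            B.indicator (fun _ => (1 : ℝ≥0∞)) (Φ R i) :=
          fun i => hind.comp ((measurable_pi_apply (i : ℕ)).comp hmeas)
        rw [lintegral_finsetSum _ fun i _ => hcomp i]
        refine Finset.sum_congr rfl fun i _ => ?_
        set F : ℝ → ℝ≥0∞ := fun y => B.indicator (fun _ => (1 : ℝ≥0∞))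
          (max (K i * δ) (min y ((K i + 1) * δ))) with hF
        have hFm : Measurable F := (measurable_const.indicator hB).comp (by fun_prop)
        have h1 : (fun R : Fin m → ℝ => B.indicator (fun _ => (1 : ℝ≥0∞)) (Φ R i)) =
            fun R => F (R i) := by
          ext R
          rw [hΦi]
        rw [h1, (measurePreserving_eval (fun i => cellMeasure δ (K i)) i).lintegral_comp hFm]
        rw [← lintegral_indicator_one hB]
        refine lintegral_congr_ae ?_
        have hmem : ∀ᵐ y ∂cellMeasure δ (K i), y ∈ Ico ((K i : ℕ) * δ) (((K i : ℕ) + 1) * δ) :=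
          ProbabilityTheory.ae_cond_mem measurableSet_Ico
        filter_upwards [hmem] with y hy
        simp only [hF]
        rw [min_eq_left hy.2.le, max_eq_right hy.1]
        rfl

/-- The uniform measures on the cells of `[0, r]` sum up to a multiple of the uniform measure. -/
theorem sum_cellMeasure_le {δ r : ℝ} (hδ : 0 < δ) (hr : 0 < r) {n : ℕ} (hn : n * δ ≤ r) (B : Set ℝ) :
    ∑ k : Fin n, cellMeasure δ k B ≤ ENNReal.ofReal (r / δ) * uniformMeasure 0 r B := by
  have hcell : ∀ k : ℕ, cellMeasure δ k B =
      (ENNReal.ofReal δ)⁻¹ * volume.restrict B (Ico (k * δ) ((k + 1) * δ)) := by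
    intro k
    rw [cellMeasure, ProbabilityTheory.cond_apply measurableSet_Ico, Real.volume_Ico,
      Measure.restrict_apply measurableSet_Ico]
    congr 3
    ring
  have hU : ENNReal.ofReal (r / δ) * uniformMeasure 0 r B =
      (ENNReal.ofReal δ)⁻¹ * volume.restrict B (Icc 0 r) := by
    rw [uniformMeasure, ProbabilityTheory.cond_apply measurableSet_Icc, Real.volume_Icc,
      Measure.restrict_apply measurableSet_Icc, ← mul_assoc, sub_zero,
      ENNReal.ofReal_div_of_pos hδ, div_eq_mul_inv]
    rw [mul_comm (ENNReal.ofReal r), mul_assoc (ENNReal.ofReal δ)⁻¹,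
      ENNReal.mul_inv_cancel (by simpa using hr) ENNReal.ofReal_ne_top, mul_one]
  simp only [hcell]
  rw [hU, ← Finset.mul_sum]
  gcongr
  have hd : Pairwise (Function.onFun Disjoint fun k : Fin n =>
      Ico ((k : ℕ) * δ) (((k : ℕ) + 1) * δ)) := by
    have key : ∀ i j : Fin n, i < j → Disjoint (Ico ((i : ℕ) * δ) (((i : ℕ) + 1) * δ))
        (Ico ((j : ℕ) * δ) (((j : ℕ) + 1) * δ)) := by
      intro i j hij
      rw [Set.disjoint_left]
      intro y hy hy'
      have h1 : ((i : ℕ) + 1 : ℝ) ≤ (j : ℕ) := by exact_mod_cast hij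
      have h2 : ((i : ℕ) + 1 : ℝ) * δ ≤ (j : ℕ) * δ := by gcongr
      linarith [hy.2, hy'.1]
    intro i j hij
    rcases lt_or_gt_of_ne hij with h | h
    exacts [key i j h, (key j i h).symm]
  rw [← tsum_fintype (L := SummationFilter.unconditional _), ← measure_iUnion hd fun k => measurableSet_Ico]
  refine measure_mono (iUnion_subset fun k y hy => ⟨le_trans (by positivity) hy.1, ?_⟩)
  have h1 : ((k : ℕ) + 1 : ℝ) ≤ n := by exact_mod_cast k.2
  exact hy.2.le.trans (le_trans (by gcongr) hn)

theorem theoremt (ε r : ℝ) (hε : 0 < ε) (hr : 0 < r) (T : MetricTree.{u})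
    (hT : 24 * ε⁻¹ * r ≤ T.length) :
    ∃ ν : Measure (T.goodCovers r), IsProbabilityMeasure ν ∧
      expectationMeasure ν ≤
        ENNReal.ofReal ((1 + ε) * (T.length / r)) • uniformMeasure 0 r := by
  have hl : 0 < T.length := lt_of_lt_of_le (by positivity) hT
  have hrl : 24 * r ≤ ε * T.length := by
    rw [mul_comm 24, mul_assoc, inv_mul_le_iff₀ hε] at hT
    exact hT
  obtain ⟨n, hn⟩ := exists_nat_gt (max 1 (4 * (1 + ε) / ε))
  have hn1 : (1 : ℝ) < n := (le_max_left _ _).trans_lt hn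
  have hnε : 4 * (1 + ε) < n * ε := by
    rw [← div_lt_iff₀ hε]
    exact (le_max_right _ _).trans_lt hn
  have hn0 : 0 < n := by
    have : (0 : ℝ) < n := by linarith
    exact_mod_cast this
  set δ : ℝ := r / (n + 1 : ℕ) with hδ
  have hδ0 : 0 < δ := by positivity
  have hδr : ((n + 1 : ℕ) : ℝ) * δ = r := by
    rw [hδ]
    field_simp
  set c' : ℝ := (1 + ε) * T.length * δ / r ^ 2 with hc'
  have hcc : (T.length + 2 * (n * δ)) / (n ^ 2 * δ) < c' := by
    rw [hc', div_lt_div_iff₀ (by positivity) (by positivity), ← hδr]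
    push_cast at hδr ⊢
    -- The lower bound on `|T|` absorbs the additional cost `2 n δ ≤ 2 r`.
    have h1 : T.length + 2 * (n * δ) ≤ T.length * (1 + ε / 12) := by nlinarith
    have h2 : (1 + ε / 12) * (n + 1) ^ 2 < (1 + ε) * (n : ℝ) ^ 2 := by nlinarith
    calc (T.length + 2 * (n * δ)) * (((n : ℝ) + 1) * δ) ^ 2
        ≤ T.length * (1 + ε / 12) * (((n : ℝ) + 1) * δ) ^ 2 := by gcongr
      _ = T.length * δ ^ 2 * ((1 + ε / 12) * (n + 1) ^ 2) := by ring
      _ < T.length * δ ^ 2 * ((1 + ε) * (n : ℝ) ^ 2) := by gcongr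
      _ = _ := by ring
  -- The vectors that count the radii of a cover in each cell.
  classical
  set S : Set (Fin (n + 1) → ℝ) := {z | ∃ (m : ℕ) (K : Fin m → Fin (n + 1)), T.CoversFrom δ K ∧
    z = fun k => ∑ i, if K i = k then 1 else 0} with hS
  obtain ⟨z, hz, hzc⟩ := exists_mem_convexHull_lt (S := S) hcc (by
    intro W hW
    obtain ⟨m, K, hK, hsum⟩ := T.exists_coversFrom hδ0 hn0 W hW
    refine ⟨_, ⟨m, K, hK, rfl⟩, le_trans (le_of_eq ?_) hsum⟩
    simp only [Finset.sum_mul]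
    rw [Finset.sum_comm]
    simp)
  rw [convexHull_eq] at hz
  obtain ⟨ι, t, w, y, hw0, hw1, hyS, rfl⟩ := hz
  rw [Finset.centerMass_eq_of_sum_1 _ _ hw1] at hzc
  have hex : ∀ i : t, ∃ (m : ℕ) (K : Fin m → Fin (n + 1)), T.CoversFrom δ K ∧
    y i = fun k => ∑ i, if K i = k then 1 else 0 := fun i => hyS i i.2
  choose m K hK hy using hex
  choose ν hν1 hν2 using fun i => exists_measure_of_coversFrom (r := r) hl hδ0 hδr.le (hK i)
  refine ⟨∑ i : t, ENNReal.ofReal (w i) • ν i, ⟨?_⟩, ?_⟩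
  · simp only [Measure.finsetSum_apply, Measure.smul_apply, measure_univ, smul_eq_mul, mul_one]
    rw [← ENNReal.ofReal_sum_of_nonneg fun (i : t) _ => hw0 i i.2, Finset.sum_coe_sort t w, hw1]
    simp
  refine Measure.le_iff.2 fun B hB => ?_
  rw [expectationMeasure_apply _ hB, lintegral_finsetSum_measure]
  simp only [lintegral_smul_measure, smul_eq_mul, Measure.smul_apply]
  have hcoef : ∀ k, ∑ i : t, ENNReal.ofReal (w i) * ∑ a, (if K i a = k then 1 else 0) ≤
      ENNReal.ofReal c' := by
    intro k
    have h1 : ∀ i : t, ENNReal.ofReal (w i) * ∑ a, (if K i a = k then 1 else 0) =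
        ENNReal.ofReal (w i * y i k) := by
      intro i
      rw [ENNReal.ofReal_mul (hw0 i i.2), hy i, ENNReal.ofReal_sum_of_nonneg (by
        intro a _; split_ifs <;> norm_num)]
      congr 1
      refine Finset.sum_congr rfl fun a _ => ?_
      split_ifs <;> simp
    simp only [h1]
    rw [← ENNReal.ofReal_sum_of_nonneg fun (i : t) _ => mul_nonneg (hw0 i i.2) (by
      rw [hy i]
      exact Finset.sum_nonneg fun a _ => by split_ifs <;> norm_num)]
    refine ENNReal.ofReal_le_ofReal (le_trans (le_of_eq ?_) (hzc k).le)
    rw [Finset.sum_coe_sort t fun i => w i * y i k]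
    simp
  calc ∑ i : t, ENNReal.ofReal (w i) * ∫⁻ R, (RadiiSeq.count B R : ℝ≥0∞) ∂(ν i)
      ≤ ∑ i : t, ENNReal.ofReal (w i) * ∑ a, cellMeasure δ (K i a) B := by
        gcongr with i
        exact hν2 i B hB
    _ = ∑ k : Fin (n + 1), (∑ i : t, ENNReal.ofReal (w i) * ∑ a, (if K i a = k then 1 else 0)) *
          cellMeasure δ k B := by
        simp only [Finset.sum_mul, mul_assoc]
        rw [Finset.sum_comm]
        refine Finset.sum_congr rfl fun i _ => ?_
        rw [← Finset.mul_sum, Finset.sum_comm]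
        simp
    _ ≤ ∑ k : Fin (n + 1), ENNReal.ofReal c' * cellMeasure δ k B := by
        gcongr with k
        exact hcoef k
    _ ≤ ENNReal.ofReal c' * (ENNReal.ofReal (r / δ) * uniformMeasure 0 r B) := by
        rw [← Finset.mul_sum]
        gcongr
        exact sum_cellMeasure_le hδ0 hr hδr.le B
    _ = _ := by
        rw [← mul_assoc, ← ENNReal.ofReal_mul (by positivity)]
        congr 2
        rw [hc']
        field_simp
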